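/- Let $k \ge 2$ be an integer and let $G$ be a finite simple graph on $n$ vertices. Suppose that the minimum degree of $G$ satisfies $\delta(G) > \frac{3n}{4k}$ and that $G$ has odd girth at least $2k+1$, i.e. $G$ contains no odd cycle of length less than $2k+1$. Then $G$ is homomorphic to the cycle $C_{2k+1}$ of length $2k+1$, i.e. there is a map $\phi\colon V(G)\to V(C_{2k+1})$ such that $\{\phi(u),\phi(w)\}$ is an edge of $C_{2k+1}$ whenever $\{u,w\}$ is an edge of $G$. -/

import Mathlib

/-- A graph `G` has odd girth at least `g` if it contains no odd cycle of length less than `g`. -/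
def SimpleGraph.OddGirthAtLeast {V : Type*} (G : SimpleGraph V) (g : ℕ) : Prop :=
  ∀ (v : V) (c : G.Walk v v), c.IsCycle → Odd c.length → g ≤ c.length

/-- `G` is homomorphic to `H` if there is a graph homomorphism from `G` into `H`. -/
def SimpleGraph.IsHomomorphicTo {V W : Type*} (G : SimpleGraph V) (H : SimpleGraph W) : Prop :=
  Nonempty (G →g H)

/-! Pass to an edge-maximal supergraph without odd closed walks shorter than `2k+1`. Maximality
joins any two nonadjacent vertices by a walk of length exactly `2k-2` (`OddSaturated`), so a missing
edge always yields walks from which closed walks of length `2k+1` can be assembled.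

The degree bound enters only by double counting: the degrees along `4k` positions, repetitions
allowed, sum to more than `3n`, so some vertex sees at least four of them. On a closed walk of
length `2k+1` a vertex sees at most two positions, at cyclic distance 2. Two configurations are
treated this way. In `adj_of_ladder` the two missing chords supply walks which, with the two middle
vertices, fill `4k` positions that no vertex sees four times. In `not_hasTetrahedron` a vertex
seeing four positions of a subdivided tetrahedron lets the spokes be lengthened
(`hasTetrahedron_of_four_le`), while their total never exceeds `2k+1` (`sum_le`); hence no
tetrahedron exists.

Now fix a closed walk `C` of length `2k+1`. Being adjacent to both `C (j-1)` and `C (j+1)` for some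
`j` spreads along edges, so it holds for every vertex, and sending the vertex to `j` is the
homomorphism. Without odd closed walks the graph is bipartite and maps to an edge. -/

namespace SimpleGraph

/-! ### Walks, parity, and edge-maximal graphs of large odd girth. -/

section Walks

variable {V : Type*} {G : SimpleGraph V}

/-- There is a walk of length `n` from `u` to `v`. -/
def ReachIn (G : SimpleGraph V) (n : ℕ) (u v : V) : Prop := ∃ p : G.Walk u v, p.length = n

/-- Every closed walk of odd length has length at least `g`. -/
def OddClosedWalksAtLeast (G : SimpleGraph V) (g : ℕ) : Prop :=
  ∀ u n, G.ReachIn n u u → n % 2 = 1 → g ≤ n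

theorem ReachIn.refl (u : V) : G.ReachIn 0 u u := ⟨Walk.nil, rfl⟩

theorem Adj.reachIn {u v : V} (h : G.Adj u v) : G.ReachIn 1 u v := ⟨h.toWalk, rfl⟩

theorem ReachIn.symm {n : ℕ} {u v : V} : G.ReachIn n u v → G.ReachIn n v u := by
  rintro ⟨p, rfl⟩
  exact ⟨p.reverse, by simp⟩

theorem ReachIn.trans {m n : ℕ} {u v w : V} :
    G.ReachIn m u v → G.ReachIn n v w → G.ReachIn (m + n) u w := by
  rintro ⟨p, rfl⟩ ⟨q, rfl⟩
  exact ⟨p.append q, by simp⟩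

theorem ReachIn.of_eq {m n : ℕ} {u v : V} (h : G.ReachIn m u v) (e : m = n) : G.ReachIn n u v :=
  e ▸ h

theorem OddClosedWalksAtLeast.le_add {g m n : ℕ} {u v : V} (h : G.OddClosedWalksAtLeast g)
    (hm : G.ReachIn m u v) (hn : G.ReachIn n u v) : (m + n) % 2 = 1 → g ≤ m + n :=
  h u _ (hm.trans hn.symm)

theorem ReachIn.of_seq {f : ℕ → V} {i j : ℕ} (hij : i ≤ j)
    (h : ∀ l, i ≤ l → l < j → G.Adj (f l) (f (l + 1))) : G.ReachIn (j - i) (f i) (f j) := by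
  induction j, hij using Nat.le_induction with
  | base => simpa using ReachIn.refl (f i)
  | succ j hij ih =>
    exact ((ih fun l h1 h2 ↦ h l h1 (by omega)).trans (h j hij (by omega)).reachIn).of_eq (by omega)

theorem ReachIn.exists_seq {n : ℕ} {u v : V} (h : G.ReachIn n u v) :
    ∃ f : ℕ → V, f 0 = u ∧ f n = v ∧ ∀ i < n, G.Adj (f i) (f (i + 1)) := by
  obtain ⟨p, rfl⟩ := h
  exact ⟨p.getVert, by simp, by simp, fun i hi ↦ p.adj_getVert_succ hi⟩

/-- A repeated vertex splits an odd closed walk into two shorter closed walks, exactly one of which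
is odd. -/
theorem Walk.exists_odd_cycle_length_le (n : ℕ) : ∀ {u : V} (p : G.Walk u u), p.length = n →
    Odd n → ∃ (v : V) (c : G.Walk v v), c.IsCycle ∧ Odd c.length ∧ c.length ≤ n := by
  induction n using Nat.strong_induction_on with
  | _ n ih =>
  intro u p hp hn
  cases p with
  | nil => simp at hp; subst hp; simp at hn
  | @cons _ v _ h q =>
    rw [Walk.length_cons] at hp
    by_cases hq : q.IsPath
    · refine ⟨u, Walk.cons h q, (Walk.cons_isCycle_iff q h).2 ⟨hq, fun he ↦ ?_⟩, ?_, ?_⟩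
      · rw [Sym2.eq_swap] at he
        have := hq.length_eq_one_of_mem_edges he
        rw [← hp, this] at hn
        exact absurd hn (by decide)
      · rwa [Walk.length_cons, hp]
      · rw [Walk.length_cons, hp]
    · rw [← Walk.IsPath.getVert_injOn_iff] at hq
      have : ∃ i j, i < j ∧ j ≤ q.length ∧ q.getVert i = q.getVert j := by
        simp only [Set.InjOn, Set.mem_ofPred_eq, not_forall] at hq
        obtain ⟨i, hi, j, hj, e, hne⟩ := hq
        rcases lt_or_gt_of_ne hne with h | h
        exacts [⟨i, j, h, hj, e⟩, ⟨j, i, h, hi, e.symm⟩]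
      obtain ⟨i, j, hij, hj, e⟩ := this
      have hloop : G.ReachIn (j - i) (q.getVert i) (q.getVert i) := by
        have := ReachIn.of_seq (G := G) (f := q.getVert) hij.le
          (fun l _ hl ↦ q.adj_getVert_succ (by omega))
        rwa [← e] at this
      have hrest : G.ReachIn (1 + i + (q.length - j)) u u := by
        have h1 := ReachIn.of_seq (G := G) (f := q.getVert) (Nat.zero_le i)
          (fun l _ hl ↦ q.adj_getVert_succ (by omega))
        have h2 := ReachIn.of_seq (G := G) (f := q.getVert) hj
          (fun l _ hl ↦ q.adj_getVert_succ (by omega))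
        rw [q.getVert_zero, e] at h1
        rw [q.getVert_length] at h2
        exact ((h.reachIn.trans h1).trans h2).of_eq (by omega)
      obtain ⟨p1, hp1⟩ := hloop
      obtain ⟨p2, hp2⟩ := hrest
      rw [Nat.odd_iff] at hn
      rcases Nat.mod_two_eq_zero_or_one (j - i) with h0 | h0
      · obtain ⟨w, c, hc, ho, hl⟩ := ih _ (by omega) p2 hp2 (Nat.odd_iff.2 (by omega))
        exact ⟨w, c, hc, ho, by omega⟩
      · obtain ⟨w, c, hc, ho, hl⟩ := ih _ (by omega) p1 hp1 (Nat.odd_iff.2 h0)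
        exact ⟨w, c, hc, ho, by omega⟩

theorem OddGirthAtLeast.oddClosedWalksAtLeast {g : ℕ} (h : G.OddGirthAtLeast g) :
    G.OddClosedWalksAtLeast g := by
  rintro u n ⟨p, hp⟩ hn
  obtain ⟨v, c, hc, ho, hl⟩ := Walk.exists_odd_cycle_length_le n p hp (Nat.odd_iff.2 hn)
  exact (h v c hc ho).trans hl

/-- A walk in `G ⊔ edge u v` can be shortened, keeping its parity, so that it uses the new edge
at most once, if all odd closed walks of `G` and all even walks of `G` from `u` to `v` are long. -/
theorem Walk.reachIn_of_sup_edge {k : ℕ} {u v : V} (hG : G.OddClosedWalksAtLeast (2 * k + 1))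
    (huv : ∀ n, G.ReachIn n u v → n % 2 = 0 → 2 * k ≤ n) {x y : V}
    (p : (G ⊔ edge u v).Walk x y) : p.length < 2 * k + 1 →
    (∃ m, m ≤ p.length ∧ m % 2 = p.length % 2 ∧ G.ReachIn m x y) ∨
    ∃ a b, a + b + 1 ≤ p.length ∧ (a + b + 1) % 2 = p.length % 2 ∧
      (G.ReachIn a x u ∧ G.ReachIn b v y ∨ G.ReachIn a x v ∧ G.ReachIn b u y) := by
  induction p with
  | nil => exact fun _ ↦ Or.inl ⟨0, by simp, by simp, .refl _⟩
  | @cons x z y h p ih =>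
    intro hl
    rw [Walk.length_cons] at hl
    rw [Walk.length_cons]
    specialize ih (by omega)
    have key : G.Adj x z ∨ (x = u ∧ z = v ∨ x = v ∧ z = u) := by
      rw [sup_adj, edge_adj] at h
      tauto
    rcases key with h | ⟨rfl, rfl⟩ | ⟨rfl, rfl⟩
    · rcases ih with ⟨m, h1, h2, h3⟩ | ⟨a, b, h1, h2, h3⟩
      · exact Or.inl ⟨1 + m, by omega, by omega, h.reachIn.trans h3⟩
      · refine Or.inr ⟨1 + a, b, by omega, by omega, ?_⟩
        rcases h3 with h3 | h3
        · exact Or.inl ⟨h.reachIn.trans h3.1, h3.2⟩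
        · exact Or.inr ⟨h.reachIn.trans h3.1, h3.2⟩
    · rcases ih with ⟨m, h1, h2, h3⟩ | ⟨a, b, h1, h2, h3 | h3⟩
      · exact Or.inr ⟨0, m, by omega, by omega, Or.inl ⟨.refl _, h3⟩⟩
      · have := huv a h3.1.symm
        exact Or.inr ⟨0, b, by omega, by omega, Or.inl ⟨.refl _, h3.2⟩⟩
      · have := hG _ _ h3.1
        exact Or.inl ⟨b, by omega, by omega, h3.2⟩
    · rcases ih with ⟨m, h1, h2, h3⟩ | ⟨a, b, h1, h2, h3 | h3⟩
      · exact Or.inr ⟨0, m, by omega, by omega, Or.inr ⟨.refl _, h3⟩⟩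
      · have := hG _ _ h3.1
        exact Or.inl ⟨b, by omega, by omega, h3.2⟩
      · have := huv a h3.1
        exact Or.inr ⟨0, b, by omega, by omega, Or.inr ⟨.refl _, h3.2⟩⟩

/-- A short odd closed walk using the new edge once leaves, after deleting that edge, an even walk
between `u` and `v` of length below `2k`. -/
theorem OddClosedWalksAtLeast.sup_edge {k : ℕ} {u v : V}
    (hG : G.OddClosedWalksAtLeast (2 * k + 1))
    (huv : ∀ n, G.ReachIn n u v → n % 2 = 0 → 2 * k ≤ n) :
    (G ⊔ edge u v).OddClosedWalksAtLeast (2 * k + 1) := by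
  rintro x n ⟨p, rfl⟩ hn
  by_contra! hl
  rcases p.reachIn_of_sup_edge hG huv hl with ⟨m, h1, h2, h3⟩ | ⟨a, b, h1, h2, h3 | h3⟩
  · have := hG _ _ h3
    omega
  · have := huv _ (h3.1.symm.trans h3.2.symm)
    omega
  · have := huv _ (h3.2.trans h3.1)
    omega

theorem ReachIn.add_two_mul {n : ℕ} {u v : V} (h : G.ReachIn n u v) (hv : ∃ w, G.Adj v w) (m : ℕ) :
    G.ReachIn (n + 2 * m) u v := by
  obtain ⟨w, hw⟩ := hv
  induction m with
  | zero => exact h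
  | succ m ih => exact ((ih.trans hw.reachIn).trans hw.symm.reachIn).of_eq (by omega)

/-- `G` is edge-maximal among the graphs without odd closed walks of length less than `2k+1`:
nonadjacent vertices are joined by a walk of length `2k-2`. -/
structure OddSaturated (G : SimpleGraph V) (k : ℕ) : Prop where
  odd : G.OddClosedWalksAtLeast (2 * k + 1)
  reach : ∀ u v, ¬ G.Adj u v → G.ReachIn (2 * k - 2) u v

theorem OddClosedWalksAtLeast.exists_oddSaturated [Finite V] {k : ℕ} (hk : 2 ≤ k)
    (h : G.OddClosedWalksAtLeast (2 * k + 1)) (hne : ∀ v, ∃ w, G.Adj v w) :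
    ∃ H : SimpleGraph V, G ≤ H ∧ H.OddSaturated k := by
  obtain ⟨H, hGH, hH⟩ := Set.Finite.exists_le_maximal
    (s := {H : SimpleGraph V | H.OddClosedWalksAtLeast (2 * k + 1)}) (Set.toFinite _) h
  refine ⟨H, hGH, hH.1, fun u v huv ↦ ?_⟩
  have hne' : ∃ w, H.Adj v w := (hne v).imp fun w hw ↦ hGH hw
  suffices ∃ n, H.ReachIn n u v ∧ n % 2 = 0 ∧ n < 2 * k by
    obtain ⟨n, h1, h2, h3⟩ := this
    -- A shorter even walk is padded to length `2k-2` by going back and forth along an edge at `v`.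
    exact (h1.add_two_mul hne' ((2 * k - 2 - n) / 2)).of_eq (by omega)
  by_cases e : u = v
  · subst e
    exact ⟨0, .refl _, rfl, by omega⟩
  by_contra! hcon
  have := hH.2 (hH.1.sup_edge hcon) le_sup_left
  exact huv (this (by simp [sup_adj, edge_adj, e]))

end Walks

end SimpleGraph

namespace SimpleGraph

/-! ### Counting neighbours of a vertex along a sequence. -/

section Counting

open Finset

variable {V : Type*} {G : SimpleGraph V}

open Classical in
/-- The number of indices in `[a, b]` at which the sequence `f` visits a neighbour of `v`. -/
noncomputable def nbrCount (G : SimpleGraph V) (v : V) (f : ℕ → V) (a b : ℕ) : ℕ :=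
  #{i ∈ Icc a b | G.Adj v (f i)}

theorem nbrCount_split {v : V} {f : ℕ → V} {a b c : ℕ} (hab : a ≤ b + 1) (hbc : b ≤ c) :
    G.nbrCount v f a c = G.nbrCount v f a b + G.nbrCount v f (b + 1) c := by
  classical
  unfold nbrCount
  rw [← card_union_of_disjoint, ← filter_union]
  · congr 2
    ext i
    simp only [mem_union, mem_Icc]
    omega
  · refine disjoint_filter_filter ?_
    rw [Finset.disjoint_left]
    intro i
    simp only [mem_Icc]
    omega

theorem nbrCount_congr {v : V} {f g : ℕ → V} {a b : ℕ} (h : ∀ i, a ≤ i → i ≤ b → f i = g i) :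
    G.nbrCount v f a b = G.nbrCount v g a b := by
  classical
  unfold nbrCount
  congr 1
  refine filter_congr fun i hi ↦ ?_
  rw [mem_Icc] at hi
  rw [h i hi.1 hi.2]

theorem nbrCount_eq_of_reflect {v : V} {f g : ℕ → V} {m n : ℕ} (hm : m < n)
    (h : ∀ i, 1 ≤ i → i ≤ m → g i = f (n - i)) :
    G.nbrCount v f (n - m) (n - 1) = G.nbrCount v g 1 m := by
  classical
  unfold nbrCount
  refine card_bij' (fun i _ ↦ n - i) (fun i _ ↦ n - i) ?_ ?_ ?_ ?_
  · intro i hi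
    simp only [mem_filter, mem_Icc] at hi
    refine mem_filter.2 ⟨mem_Icc.2 ⟨by omega, by omega⟩, ?_⟩
    rw [h (n - i) (by omega) (by omega), show n - (n - i) = i by omega]
    exact hi.2
  · intro i hi
    simp only [mem_filter, mem_Icc] at hi
    exact mem_filter.2 ⟨mem_Icc.2 ⟨by omega, by omega⟩, h i (by omega) (by omega) ▸ hi.2⟩
  · intro i hi
    simp only [mem_filter, mem_Icc] at hi
    exact Nat.sub_sub_self (by omega)
  · intro i hi
    simp only [mem_filter, mem_Icc] at hi
    exact Nat.sub_sub_self (by omega)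

theorem exists_of_one_le_nbrCount {v : V} {f : ℕ → V} {a b : ℕ} (h : 1 ≤ G.nbrCount v f a b) :
    ∃ i, a ≤ i ∧ i ≤ b ∧ G.Adj v (f i) := by
  classical
  obtain ⟨i, hi⟩ := card_pos.1 h
  simp only [mem_filter, mem_Icc] at hi
  exact ⟨i, hi.1.1, hi.1.2, hi.2⟩

theorem exists_of_two_le_nbrCount {v : V} {f : ℕ → V} {a b : ℕ} (h : 2 ≤ G.nbrCount v f a b) :
    ∃ i j, a ≤ i ∧ i < j ∧ j ≤ b ∧ G.Adj v (f i) ∧ G.Adj v (f j) := by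
  classical
  obtain ⟨i, hi, j, hj, hne⟩ := one_lt_card.1 h
  simp only [mem_filter, mem_Icc] at hi hj
  rcases lt_or_gt_of_ne hne with h | h
  · exact ⟨i, j, by omega, h, by omega, hi.2, hj.2⟩
  · exact ⟨j, i, by omega, h, by omega, hj.2, hi.2⟩

theorem nbrCount_le_one {v : V} {f : ℕ → V} {a b : ℕ}
    (h : ∀ i j, a ≤ i → i < j → j ≤ b → G.Adj v (f i) → G.Adj v (f j) → False) :
    G.nbrCount v f a b ≤ 1 := by
  by_contra! hc
  obtain ⟨i, j, h1, h2, h3, h4, h5⟩ := exists_of_two_le_nbrCount hc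
  exact h i j h1 h2 h3 h4 h5

theorem nbrCount_le_two {v : V} {f : ℕ → V} {a b : ℕ}
    (h : ∀ i j l, a ≤ i → i < j → j < l → l ≤ b →
      G.Adj v (f i) → G.Adj v (f j) → G.Adj v (f l) → False) :
    G.nbrCount v f a b ≤ 2 := by
  classical
  by_contra! hc
  obtain ⟨x, hx, y, hy, z, hz, hxy, hxz, hyz⟩ := two_lt_card.1 hc
  simp only [mem_filter, mem_Icc] at hx hy hz
  rcases lt_or_gt_of_ne hxy with h1 | h1 <;> rcases lt_or_gt_of_ne hxz with h2 | h2 <;>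
    rcases lt_or_gt_of_ne hyz with h3 | h3
  · exact h x y z (by omega) h1 h3 (by omega) hx.2 hy.2 hz.2
  · exact h x z y (by omega) h2 h3 (by omega) hx.2 hz.2 hy.2
  · omega
  · exact h z x y (by omega) h2 h1 (by omega) hz.2 hx.2 hy.2
  · exact h y x z (by omega) h1 h2 (by omega) hy.2 hx.2 hz.2
  · omega
  · exact h y z x (by omega) h3 h2 (by omega) hy.2 hz.2 hx.2
  · exact h z y x (by omega) h3 h1 (by omega) hz.2 hy.2 hx.2

theorem one_le_nbrCount {v : V} {f : ℕ → V} {a b : ℕ} (i : ℕ) (h : G.Adj v (f i)) (ha : a ≤ i)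
    (hb : i ≤ b) : 1 ≤ G.nbrCount v f a b := by
  classical
  exact card_pos.2 ⟨i, by simp [h, ha, hb]⟩

theorem two_le_nbrCount {v : V} {f : ℕ → V} {a b : ℕ} (i j : ℕ) (hi : G.Adj v (f i))
    (hj : G.Adj v (f j)) (ha : a ≤ i) (hij : i < j) (hb : j ≤ b) : 2 ≤ G.nbrCount v f a b := by
  classical
  refine one_lt_card.2 ⟨i, ?_, j, ?_, hij.ne⟩
  · simp only [mem_filter, mem_Icc]
    exact ⟨by omega, hi⟩
  · simp only [mem_filter, mem_Icc]
    exact ⟨by omega, hj⟩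

/-- All degrees are larger than `3n/(4k)`. -/
def DegreesLarge [Fintype V] (G : SimpleGraph V) (k : ℕ) : Prop :=
  ∀ v, 3 * Fintype.card V < 4 * k * (G.neighborSet v).ncard

theorem DegreesLarge.mono [Fintype V] {H : SimpleGraph V} {k : ℕ} (h : G.DegreesLarge k)
    (hGH : G ≤ H) : H.DegreesLarge k := fun v ↦
  (h v).trans_le (Nat.mul_le_mul_left _ (Set.ncard_le_ncard (fun _ hw ↦ hGH hw) (Set.toFinite _)))

/-- Double counting of adjacent pairs. The `+ 1` keeps the strictness of the degree bound over the
naturals. -/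
theorem DegreesLarge.le_sum_nbrCount [Fintype V] {k : ℕ} (h : G.DegreesLarge k) (f : ℕ → V)
    (a b : ℕ) :
    (b + 1 - a) * (3 * Fintype.card V + 1) ≤ 4 * k * ∑ v, G.nbrCount v f a b := by
  classical
  have key : ∑ v, G.nbrCount v f a b = ∑ i ∈ Icc a b, (G.neighborSet (f i)).ncard := by
    refine (sum_card_bipartiteAbove_eq_sum_card_bipartiteBelow
      (s := (univ : Finset V)) (t := Icc a b) (fun v i ↦ G.Adj v (f i))).trans ?_
    refine sum_congr rfl fun i _ ↦ ?_
    rw [Set.ncard_eq_toFinset_card']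
    congr 1
    ext v
    simp [bipartiteBelow, adj_comm]
  rw [key, mul_sum, ← Nat.card_Icc, ← smul_eq_mul]
  exact card_nsmul_le_sum _ _ _ fun i _ ↦ h (f i)

end Counting

/-! ### Closed walks of length `2k+1` and the ladder lemma. -/

section ClosedSequences

variable {V : Type*} {G : SimpleGraph V} {k : ℕ}

/-- `f 0, …, f n` is a closed walk of length `n`. -/
structure ClosedSeq (G : SimpleGraph V) (n : ℕ) (f : ℕ → V) : Prop where
  closed : f n = f 0
  adj : ∀ i < n, G.Adj (f i) (f (i + 1))

theorem ClosedSeq.reachIn {n i j : ℕ} {f : ℕ → V} (hf : G.ClosedSeq n f) (hij : i ≤ j)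
    (hj : j ≤ n) : G.ReachIn (j - i) (f i) (f j) :=
  ReachIn.of_seq hij fun l _ hl ↦ hf.adj l (by omega)

theorem ClosedSeq.reachIn_around {n i j : ℕ} {f : ℕ → V} (hf : G.ClosedSeq n f) (hij : i ≤ j)
    (hj : j ≤ n) : G.ReachIn (n - (j - i)) (f i) (f j) := by
  have h1 := hf.reachIn (Nat.zero_le i) (hij.trans hj)
  have h2 := hf.reachIn hj le_rfl
  rw [hf.closed] at h2
  exact (h2.trans h1).symm.of_eq (by omega)

theorem ClosedSeq.reverse {n : ℕ} {f : ℕ → V} (hf : G.ClosedSeq n f) :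
    G.ClosedSeq n fun i ↦ f (n - i) where
  closed := by simp [hf.closed]
  adj i hi := by
    have := (hf.adj (n - (i + 1)) (by omega)).symm
    rwa [show n - (i + 1) + 1 = n - i by omega] at this

/-- The two arcs between the positions have opposite parity; the odd one, closed up through `v`, has
length at least `2k+1`, which leaves an arc of length at most 2 on the other side. -/
theorem ClosedSeq.sub_eq (hG : G.OddClosedWalksAtLeast (2 * k + 1)) {f : ℕ → V}
    (hf : G.ClosedSeq (2 * k + 1) f) {v : V} {i j : ℕ} (hij : i < j) (hj : j ≤ 2 * k)
    (hi : G.Adj v (f i)) (hvj : G.Adj v (f j)) : j = i + 2 ∨ j = i + (2 * k - 1) := by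
  have h2 := hi.reachIn.symm.trans hvj.reachIn
  have h3 := hG.le_add h2 (hf.reachIn hij.le (by omega))
  have h4 := hG.le_add h2 (hf.reachIn_around hij.le (by omega))
  omega

theorem ClosedSeq.not_adj_three (hk : 2 ≤ k) (hG : G.OddClosedWalksAtLeast (2 * k + 1))
    {f : ℕ → V} (hf : G.ClosedSeq (2 * k + 1) f) {v : V} {i j l : ℕ} (hij : i < j) (hjl : j < l)
    (hl : l ≤ 2 * k) (hi : G.Adj v (f i)) (hvj : G.Adj v (f j)) (hvl : G.Adj v (f l)) : False := by
  have h1 := hf.sub_eq hG hij (by omega) hi hvj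
  have h2 := hf.sub_eq hG hjl hl hvj hvl
  have h3 := hf.sub_eq hG (hij.trans hjl) hl hi hvl
  omega

theorem ClosedSeq.nbrCount_le_two (hk : 2 ≤ k) (hG : G.OddClosedWalksAtLeast (2 * k + 1))
    {f : ℕ → V} (hf : G.ClosedSeq (2 * k + 1) f) (v : V) : G.nbrCount v f 0 (2 * k) ≤ 2 :=
  SimpleGraph.nbrCount_le_two fun _ _ _ _ h1 h2 h3 h4 h5 h6 ↦
    hf.not_adj_three hk hG h1 h2 h3 h4 h5 h6

/-- A walk of length `2k-2` from `u` to `v` and a path `v, a, b, u` form a closed walk. -/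
theorem ClosedSeq.of_path {p : ℕ → V} {a b : V} (hk : 2 ≤ k)
    (hp : ∀ i < 2 * k - 2, G.Adj (p i) (p (i + 1))) (ha : G.Adj (p (2 * k - 2)) a)
    (hab : G.Adj a b) (hb : G.Adj b (p 0)) :
    G.ClosedSeq (2 * k + 1) fun i ↦
      if i ≤ 2 * k - 2 then p i else if i = 2 * k - 1 then a else if i = 2 * k then b else p 0 where
  closed := by
    simp only [Nat.zero_le, if_true]
    rw [if_neg (by omega), if_neg (by omega), if_neg (by omega)]
  adj i hi := by
    rcases lt_or_ge i (2 * k - 2) with h | h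
    · simp only [h.le, if_true, show i + 1 ≤ 2 * k - 2 by omega]
      exact hp i h
    · obtain rfl | rfl | rfl : i = 2 * k - 2 ∨ i = 2 * k - 1 ∨ i = 2 * k := by omega
      · simp only [le_refl, if_true]
        rw [if_neg (by omega), if_pos (by omega)]
        exact ha
      · simp only [if_true]
        rw [if_neg (by omega), if_neg (by omega), if_neg (by omega), if_pos (by omega)]
        exact hab
      · simp only [if_true]
        rw [if_neg (by omega), if_neg (by omega), if_neg (by omega), if_neg (by omega),
          if_neg (by omega)]
        exact hb

/-- The neighbours of a vertex on a walk of length `2k-2` between two vertices at distance 3. -/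
theorem sub_eq_of_path {p : ℕ → V} {a b : V} (hk : 2 ≤ k)
    (hG : G.OddClosedWalksAtLeast (2 * k + 1))
    (hp : ∀ i < 2 * k - 2, G.Adj (p i) (p (i + 1))) (ha : G.Adj (p (2 * k - 2)) a)
    (hab : G.Adj a b) (hb : G.Adj b (p 0)) {v : V} :
    (∀ i j, i < j → j ≤ 2 * k - 2 → G.Adj v (p i) → G.Adj v (p j) → j = i + 2) ∧
    (∀ i, i ≤ 2 * k - 2 → G.Adj v (p i) → G.Adj v a → i = 2 * k - 3 ∨ i = 0) ∧
    (∀ i, i ≤ 2 * k - 2 → G.Adj v (p i) → G.Adj v b → i = 2 * k - 2 ∨ i = 1) := by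
  have hf := ClosedSeq.of_path hk hp ha hab hb
  refine ⟨fun i j hij hj h1 h2 ↦ ?_, fun i hi h1 h2 ↦ ?_, fun i hi h1 h2 ↦ ?_⟩
  · have := hf.sub_eq hG (v := v) hij (by omega) (by rwa [if_pos (by omega)])
      (by rwa [if_pos (by omega)])
    omega
  · have := hf.sub_eq hG (v := v) (i := i) (j := 2 * k - 1) (by omega) (by omega)
      (by rwa [if_pos (by omega)]) (by rwa [if_neg (by omega), if_pos rfl])
    omega
  · have := hf.sub_eq hG (v := v) (i := i) (j := 2 * k) (by omega) (by omega)
      (by rwa [if_pos (by omega)]) (by rwa [if_neg (by omega), if_neg (by omega), if_pos rfl])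
    omega

/-- A six-cycle with a chord joining opposite vertices has a second such chord. -/
theorem OddSaturated.adj_of_ladder [Fintype V] (hk : 2 ≤ k) (hG : G.OddSaturated k)
    (hdeg : G.DegreesLarge k) {x₀ x₁ x₂ y₀ y₁ y₂ : V} (hx : G.Adj x₀ x₁) (hx' : G.Adj x₁ x₂)
    (hy : G.Adj y₀ y₁) (hy' : G.Adj y₁ y₂) (h0 : G.Adj x₀ y₀) (h1 : G.Adj x₁ y₁)
    (h2 : G.Adj x₂ y₂) : G.Adj x₀ y₂ ∨ G.Adj x₂ y₀ := by
  by_contra! hcon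
  -- The walks `p` and `q` have `2k-1` positions each; with `x₁` and `y₁` this makes the `4k`
  -- positions needed for the count.
  obtain ⟨p, hp0, hpe, hp⟩ := (hG.reach _ _ hcon.1).exists_seq
  obtain ⟨q, hq0, hqe, hq⟩ := (hG.reach _ _ hcon.2).exists_seq
  have hodd := hG.odd
  have hle : ∀ v, G.nbrCount v p 0 (2 * k - 2) + G.nbrCount v q 0 (2 * k - 2) +
      G.nbrCount v (fun _ ↦ x₁) 1 1 + G.nbrCount v (fun _ ↦ y₁) 1 1 ≤ 3 := by
    intro v
    obtain ⟨p1, -, -⟩ := sub_eq_of_path hk hodd hp (a := y₁) (b := y₀) (hpe ▸ hy'.symm) hy.symm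
      (hp0 ▸ h0.symm) (v := v)
    obtain ⟨-, -, p4⟩ := sub_eq_of_path hk hodd hp (a := x₂) (b := x₁) (hpe ▸ h2.symm) hx'.symm
      (hp0 ▸ hx.symm) (v := v)
    obtain ⟨-, p3, -⟩ := sub_eq_of_path hk hodd hp (a := y₁) (b := y₀) (hpe ▸ hy'.symm) hy.symm
      (hp0 ▸ h0.symm) (v := v)
    obtain ⟨q1, q3, -⟩ := sub_eq_of_path hk hodd hq (a := y₁) (b := y₂) (hqe ▸ hy) hy'
      (hq0 ▸ h2.symm) (v := v)
    obtain ⟨-, -, q4⟩ := sub_eq_of_path hk hodd hq (a := x₀) (b := x₁) (hqe ▸ h0.symm) hx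
      (hq0 ▸ hx') (v := v)
    have cp : G.nbrCount v p 0 (2 * k - 2) ≤ 2 := nbrCount_le_two fun i j l _ a1 a2 a3 b1 b2 b3 ↦ by
      have := p1 i j a1 (by omega) b1 b2
      have := p1 i l (by omega) (by omega) b1 b3
      omega
    have cq : G.nbrCount v q 0 (2 * k - 2) ≤ 2 := nbrCount_le_two fun i j l _ a1 a2 a3 b1 b2 b3 ↦ by
      have := q1 i j a1 (by omega) b1 b2
      have := q1 i l (by omega) (by omega) b1 b3
      omega
    have cx1 : G.nbrCount v (fun _ ↦ x₁) 1 1 ≤ 1 := nbrCount_le_one fun i j _ _ _ _ _ ↦ by omega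
    have cy1 : G.nbrCount v (fun _ ↦ y₁) 1 1 ≤ 1 := nbrCount_le_one fun i j _ _ _ _ _ ↦ by omega
    by_cases cx : 1 ≤ G.nbrCount v (fun _ ↦ x₁) 1 1
    · obtain ⟨-, -, -, ex⟩ := exists_of_one_le_nbrCount cx
      have cy : G.nbrCount v (fun _ ↦ y₁) 1 1 < 1 := by
        by_contra! cy
        obtain ⟨-, -, -, ey⟩ := exists_of_one_le_nbrCount cy
        have := hodd.le_add (ex.reachIn.trans h1.reachIn) ey.reachIn
        omega
      have : G.nbrCount v p 0 (2 * k - 2) ≤ 1 := nbrCount_le_one fun i j _ a1 a2 b1 b2 ↦ by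
        have := p1 i j a1 a2 b1 b2
        have := p4 i (by omega) b1 ex
        have := p4 j (by omega) b2 ex
        omega
      have : G.nbrCount v q 0 (2 * k - 2) ≤ 1 := nbrCount_le_one fun i j _ a1 a2 b1 b2 ↦ by
        have := q1 i j a1 a2 b1 b2
        have := q4 i (by omega) b1 ex
        have := q4 j (by omega) b2 ex
        omega
      omega
    by_cases cy : 1 ≤ G.nbrCount v (fun _ ↦ y₁) 1 1
    · obtain ⟨-, -, -, ey⟩ := exists_of_one_le_nbrCount cy
      have : G.nbrCount v p 0 (2 * k - 2) ≤ 1 := nbrCount_le_one fun i j _ a1 a2 b1 b2 ↦ by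
        have := p1 i j a1 a2 b1 b2
        have := p3 i (by omega) b1 ey
        have := p3 j (by omega) b2 ey
        omega
      have : G.nbrCount v q 0 (2 * k - 2) ≤ 1 := nbrCount_le_one fun i j _ a1 a2 b1 b2 ↦ by
        have := q1 i j a1 a2 b1 b2
        have := q3 i (by omega) b1 ey
        have := q3 j (by omega) b2 ey
        omega
      omega
    by_contra! hc
    obtain ⟨i, i', -, hi, hi', ai, ai'⟩ :=
      exists_of_two_le_nbrCount (show 2 ≤ G.nbrCount v p 0 (2 * k - 2) by omega)
    obtain ⟨j, j', -, hj, hj', aj, aj'⟩ :=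
      exists_of_two_le_nbrCount (show 2 ≤ G.nbrCount v q 0 (2 * k - 2) by omega)
    have ei := p1 i i' hi hi' ai ai'
    have ej := q1 j j' hj hj' aj aj'
    have P : ∀ a b, a ≤ b → b ≤ 2 * k - 2 → G.ReachIn (b - a) (p a) (p b) := fun a b h h' ↦
      ReachIn.of_seq h fun l _ hl ↦ hp l (by omega)
    have Q : ∀ a b, a ≤ b → b ≤ 2 * k - 2 → G.ReachIn (b - a) (q a) (q b) := fun a b h h' ↦
      ReachIn.of_seq h fun l _ hl ↦ hq l (by omega)
    -- The closed walks of `e1` and `e2` have lengths summing to `4k`, those of `e3` and `e4` to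
    -- `4k-2`. The parity of `i + j` makes one of these pairs odd, and two odd lengths would sum to
    -- at least `4k+2`.
    have e1 := hodd.le_add
      ((ai.reachIn.trans (hp0 ▸ P 0 i (Nat.zero_le _) (by omega)).symm).trans hx.reachIn)
      ((aj.reachIn.trans (hq0 ▸ Q 0 j (Nat.zero_le _) (by omega)).symm).trans hx'.symm.reachIn)
    have e2 := hodd.le_add
      ((ai'.reachIn.trans (hpe ▸ P i' _ hi' le_rfl)).trans hy'.symm.reachIn)
      ((aj'.reachIn.trans (hqe ▸ Q j' _ hj' le_rfl)).trans hy.reachIn)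
    have e3 := hodd.le_add
      ((ai.reachIn.trans (hp0 ▸ P 0 i (Nat.zero_le _) (by omega)).symm).trans h0.reachIn)
      (aj'.reachIn.trans (hqe ▸ Q j' _ hj' le_rfl))
    have e4 := hodd.le_add
      ((ai'.reachIn.trans (hpe ▸ P i' _ hi' le_rfl)).trans h2.symm.reachIn)
      (aj.reachIn.trans (hq0 ▸ Q 0 j (Nat.zero_le _) (by omega)).symm)
    omega
  have hsum := Finset.sum_le_card_nsmul Finset.univ _ 3 fun v _ ↦ hle v
  simp only [Finset.sum_add_distrib, smul_eq_mul, Finset.card_univ] at hsum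
  have s1 := hdeg.le_sum_nbrCount p 0 (2 * k - 2)
  have s2 := hdeg.le_sum_nbrCount q 0 (2 * k - 2)
  have s3 := hdeg.le_sum_nbrCount (fun _ ↦ x₁) 1 1
  have s4 := hdeg.le_sum_nbrCount (fun _ ↦ y₁) 1 1
  have e : 2 * k - 2 + 1 - 0 = 2 * k - 1 := by omega
  rw [e] at s1 s2
  obtain ⟨m, rfl⟩ : ∃ m, k = m + 1 := ⟨k - 1, by omega⟩
  rw [show 2 * (m + 1) - 1 = 2 * m + 1 by omega] at s1 s2
  nlinarith

end ClosedSequences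

end SimpleGraph

namespace SimpleGraph

/-! ### Subdivided tetrahedra and the lengthening of their spokes. -/

section Tetrahedra

variable {V : Type*} {G : SimpleGraph V} {k α β γ : ℕ} {f g h : ℕ → V} {v : V}

/-- Three closed walks of length `2k+1` through a common vertex forming a (possibly degenerate)
subdivided tetrahedron: the walks agree pairwise, up to orientation, on spokes of lengths
`α`, `β`, `γ` starting at the common vertex. -/
structure Tetrahedron (G : SimpleGraph V) (k : ℕ) (f g h : ℕ → V) (α β γ : ℕ) : Prop where
  closed₁ : G.ClosedSeq (2 * k + 1) f
  closed₂ : G.ClosedSeq (2 * k + 1) g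
  closed₃ : G.ClosedSeq (2 * k + 1) h
  le₁ : α ≤ 2 * k
  le₂ : β ≤ 2 * k
  le₃ : γ ≤ 2 * k
  spoke₁ : ∀ i ≤ α, f i = h (2 * k + 1 - i)
  spoke₂ : ∀ i ≤ β, g i = f (2 * k + 1 - i)
  spoke₃ : ∀ i ≤ γ, h i = g (2 * k + 1 - i)

/-- Admissible spoke lengths: all are positive and at most one is equal to `1`. -/
def GoodSpokes (α β γ : ℕ) : Prop :=
  1 ≤ α ∧ 1 ≤ β ∧ 1 ≤ γ ∧ 3 ≤ α + β ∧ 3 ≤ β + γ ∧ 3 ≤ α + γ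

/-- There is a tetrahedron with admissible spokes of total length at least `m`. -/
def HasTetrahedron (G : SimpleGraph V) (k m : ℕ) : Prop :=
  ∃ f g h α β γ, G.Tetrahedron k f g h α β γ ∧ GoodSpokes α β γ ∧ m ≤ α + β + γ

namespace Tetrahedron

theorem zero₂ (T : G.Tetrahedron k f g h α β γ) : g 0 = f 0 := by
  rw [T.spoke₂ 0 (Nat.zero_le _)]
  exact T.closed₁.closed

theorem zero₃ (T : G.Tetrahedron k f g h α β γ) : h 0 = f 0 := by
  rw [T.spoke₁ 0 (Nat.zero_le _)]
  exact T.closed₃.closed.symm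

theorem rotate (T : G.Tetrahedron k f g h α β γ) : G.Tetrahedron k g h f β γ α :=
  ⟨T.closed₂, T.closed₃, T.closed₁, T.le₂, T.le₃, T.le₁, T.spoke₂, T.spoke₃, T.spoke₁⟩

theorem reflect (T : G.Tetrahedron k f g h α β γ) :
    G.Tetrahedron k (fun i ↦ h (2 * k + 1 - i)) (fun i ↦ g (2 * k + 1 - i))
      (fun i ↦ f (2 * k + 1 - i)) α γ β where
  closed₁ := T.closed₃.reverse
  closed₂ := T.closed₂.reverse
  closed₃ := T.closed₁.reverse
  le₁ := T.le₁
  le₂ := T.le₃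
  le₃ := T.le₂
  spoke₁ i hi := by
    have := T.le₁
    simp only [show 2 * k + 1 - (2 * k + 1 - i) = i by omega]
    exact (T.spoke₁ i hi).symm
  spoke₂ i hi := by
    have := T.le₃
    simp only [show 2 * k + 1 - (2 * k + 1 - i) = i by omega]
    exact (T.spoke₃ i hi).symm
  spoke₃ i hi := by
    have := T.le₂
    simp only [show 2 * k + 1 - (2 * k + 1 - i) = i by omega]
    exact (T.spoke₂ i hi).symm

/-- Otherwise `f α` lies on all three faces, and following `g` and `h` between it and `h 1` gives a
closed walk of length `(2k-α) + (α-1) = 2k-1`. -/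
theorem add_le (T : G.Tetrahedron k f g h α β γ) (hG : G.OddClosedWalksAtLeast (2 * k + 1))
    (hα : 1 ≤ α) (hγ : 1 ≤ γ) : α + β ≤ 2 * k := by
  by_contra! hc
  have hle := T.le₁
  have h1 := T.closed₃.reachIn (i := 1) (j := 2 * k + 1 - α) (by omega) (by omega)
  have h2 := T.closed₂.reachIn (i := 2 * k + 1 - α) (j := 2 * k) (by omega) (by omega)
  rw [T.spoke₂ _ (by omega), show 2 * k + 1 - (2 * k + 1 - α) = α by omega,
    T.spoke₁ _ le_rfl] at h2
  rw [T.spoke₃ 1 hγ, Nat.add_sub_cancel] at h1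
  have := hG.le_add h1 h2.symm
  omega

/-- The three arcs form a closed walk of odd length `3(2k+1) - 2(α+β+γ)`, which must be at least
`2k+1`. -/
theorem sum_le (T : G.Tetrahedron k f g h α β γ) (hG : G.OddClosedWalksAtLeast (2 * k + 1))
    (hgood : GoodSpokes α β γ) : α + β + γ ≤ 2 * k + 1 := by
  obtain ⟨hα, hβ, hγ, -⟩ := hgood
  have e1 := T.add_le hG hα hγ
  have e2 := T.rotate.add_le hG hβ hα
  have e3 := T.rotate.rotate.add_le hG hγ hβ
  have h1 := T.closed₁.reachIn (i := α) (j := 2 * k + 1 - β) (by omega) (by omega)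
  have h2 := T.closed₂.reachIn (i := β) (j := 2 * k + 1 - γ) (by omega) (by omega)
  have h3 := T.closed₃.reachIn (i := γ) (j := 2 * k + 1 - α) (by omega) (by omega)
  rw [← T.spoke₂ β le_rfl] at h1
  rw [← T.spoke₃ γ le_rfl] at h2
  rw [← T.spoke₁ α le_rfl] at h3
  have := hG _ _ ((h1.trans h2).trans h3)
  omega

theorem nbrCount_eq (T : G.Tetrahedron k f g h α β γ) (hle : α + β ≤ 2 * k) (v : V) :
    G.nbrCount v f 0 (2 * k) = G.nbrCount v f 0 0 + G.nbrCount v f 1 α +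
      G.nbrCount v f (α + 1) (2 * k - β) + G.nbrCount v g 1 β := by
  have e := nbrCount_eq_of_reflect (G := G) (v := v) (f := f) (g := g) (m := β) (n := 2 * k + 1)
    (by omega) (fun i _ hi ↦ T.spoke₂ i hi)
  rw [nbrCount_split (b := 0) (by omega) (by omega),
    nbrCount_split (a := 0 + 1) (b := α) (by omega) (by omega),
    nbrCount_split (a := α + 1) (b := 2 * k - β) (by omega) (by omega), ← e,
    show 2 * k - β + 1 = 2 * k + 1 - β by omega, Nat.add_sub_cancel, zero_add]
  ring

theorem mono (T : G.Tetrahedron k f g h α β γ) {α' β' γ' : ℕ} (hα : α' ≤ α) (hβ : β' ≤ β)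
    (hγ : γ' ≤ γ) : G.Tetrahedron k f g h α' β' γ' :=
  ⟨T.closed₁, T.closed₂, T.closed₃, hα.trans T.le₁, hβ.trans T.le₂, hγ.trans T.le₃,
    fun i hi ↦ T.spoke₁ i (hi.trans hα), fun i hi ↦ T.spoke₂ i (hi.trans hβ),
    fun i hi ↦ T.spoke₃ i (hi.trans hγ)⟩

/-- Replace the vertex at position `d` of the first face by a vertex with the same neighbours on
the face. -/
theorem update (T : G.Tetrahedron k f g h α β γ) {d : ℕ} (hd : 1 ≤ d) (hd' : d ≤ 2 * k)
    (h1 : G.Adj v (f (d - 1))) (h2 : G.Adj v (f (d + 1))) (hα : α < d) (hβ : β + d ≤ 2 * k) :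
    G.Tetrahedron k (Function.update f d v) g h α β γ where
  closed₁ := by
    refine ⟨?_, fun i hi ↦ ?_⟩
    · rw [Function.update_of_ne (by omega), Function.update_of_ne (by omega)]
      exact T.closed₁.closed
    · rcases eq_or_ne i d with rfl | hne
      · rw [Function.update_self, Function.update_of_ne (by omega)]
        exact h2
      rcases eq_or_ne (i + 1) d with rfl | hne'
      · rw [Function.update_self, Function.update_of_ne hne]
        exact h1.symm
      rw [Function.update_of_ne hne, Function.update_of_ne hne']
      exact T.closed₁.adj i hi
  closed₂ := T.closed₂
  closed₃ := T.closed₃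
  le₁ := T.le₁
  le₂ := T.le₂
  le₃ := T.le₃
  spoke₁ i hi := by
    rw [Function.update_of_ne (by omega)]
    exact T.spoke₁ i hi
  spoke₂ i hi := by
    rw [Function.update_of_ne (by omega)]
    exact T.spoke₂ i hi
  spoke₃ := T.spoke₃

/-- Lengthen the first spoke to `d` by letting the third face follow the first one. -/
theorem fold (T : G.Tetrahedron k f g h α β γ) {d : ℕ} (hd : d ≤ 2 * k)
    (hadj : G.Adj (f d) (h (2 * k - d))) (hγ : γ + d ≤ 2 * k) :
    G.Tetrahedron k f g (fun i ↦ if 2 * k + 1 - d ≤ i then f (2 * k + 1 - i) else h i) d β γ where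
  closed₁ := T.closed₁
  closed₂ := T.closed₂
  closed₃ := by
    refine ⟨?_, fun i hi ↦ ?_⟩
    · rw [if_pos (by omega), if_neg (by omega), Nat.sub_self, T.zero₃]
    · by_cases h1 : 2 * k + 1 - d ≤ i
      · rw [if_pos h1, if_pos (by omega)]
        have := (T.closed₁.adj (2 * k + 1 - (i + 1)) (by omega)).symm
        rwa [show 2 * k + 1 - (i + 1) + 1 = 2 * k + 1 - i by omega] at this
      · by_cases h2 : i = 2 * k - d
        · subst h2
          rw [if_neg h1, if_pos (by omega), show 2 * k + 1 - (2 * k - d + 1) = d by omega]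
          exact hadj.symm
        · rw [if_neg h1, if_neg (by omega)]
          exact T.closed₃.adj i hi
  le₁ := hd
  le₂ := T.le₂
  le₃ := T.le₃
  spoke₁ i hi := by
    rw [if_pos (by omega), show 2 * k + 1 - (2 * k + 1 - i) = i by omega]
  spoke₂ := T.spoke₂
  spoke₃ i hi := by
    rw [if_neg (by omega)]
    exact T.spoke₃ i hi

end Tetrahedron

theorem ClosedSeq.exists_center (hG : G.OddClosedWalksAtLeast (2 * k + 1))
    (hf : G.ClosedSeq (2 * k + 1) f) (h0 : ¬ G.Adj v (f 0))
    (h2 : 2 ≤ G.nbrCount v f 0 (2 * k)) :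
    (∃ d, 2 ≤ d ∧ d + 1 ≤ 2 * k ∧ G.Adj v (f (d - 1)) ∧ G.Adj v (f (d + 1))) ∨
      G.Adj v (f 1) ∧ G.Adj v (f (2 * k)) := by
  obtain ⟨i, j, -, hij, hj, ai, aj⟩ := exists_of_two_le_nbrCount h2
  have hi : i ≠ 0 := by rintro rfl; exact h0 ai
  rcases hf.sub_eq hG hij hj ai aj with rfl | rfl
  · exact Or.inl ⟨i + 1, by omega, by omega, by simpa using ai, by simpa using aj⟩
  · obtain rfl : i = 1 := by omega
    rw [show 1 + (2 * k - 1) = 2 * k by omega] at aj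
    exact Or.inr ⟨ai, aj⟩

/-- If `v` can replace a vertex on each of two faces sharing a spoke, the two positions correspond
under the reflection that matches the spoke. Hence the spoke can be made to run through `v`. -/
theorem ClosedSeq.center_add (hG : G.OddClosedWalksAtLeast (2 * k + 1))
    (hf : G.ClosedSeq (2 * k + 1) f) (hh : G.ClosedSeq (2 * k + 1) h) (h0 : h 0 = f 0)
    (h1 : h (2 * k) = f 1) {d e : ℕ} (hd : 2 ≤ d) (hd' : d + 1 ≤ 2 * k) (he : 2 ≤ e)
    (he' : e + 1 ≤ 2 * k) (fd : G.Adj v (f (d - 1))) (fd' : G.Adj v (f (d + 1)))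
    (ge : G.Adj v (h (e - 1))) (ge' : G.Adj v (h (e + 1))) : d + e = 2 * k + 1 := by
  have a1 := (hf.reachIn (i := 0) (j := d - 1) (by omega) (by omega)).trans fd.symm.reachIn
  have a2 := (hf.reachIn_around (i := 0) (j := d + 1) (by omega) (by omega)).trans fd'.symm.reachIn
  have a3 := (hf.reachIn (i := 1) (j := d - 1) (by omega) (by omega)).trans fd.symm.reachIn
  have b1 := (hh.reachIn (i := 0) (j := e - 1) (by omega) (by omega)).trans ge.symm.reachIn
  have b2 := (hh.reachIn_around (i := 0) (j := e + 1) (by omega) (by omega)).trans ge'.symm.reachIn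
  have b3 := (hh.reachIn (i := e + 1) (j := 2 * k) (by omega) (by omega)).symm.trans
    ge'.symm.reachIn
  rw [h0] at b1 b2
  rw [h1] at b3
  have := hG.le_add a1 b1
  have := hG.le_add a2 b2
  have := hG.le_add a1 b2
  have := hG.le_add a2 b1
  have := hG.le_add a3 b3
  omega

namespace Tetrahedron

theorem le_one_of_adj_center (T : G.Tetrahedron k f g h α β γ)
    (hG : G.OddClosedWalksAtLeast (2 * k + 1)) (h0 : G.Adj v (f 0))
    (hX : 1 ≤ G.nbrCount v f (α + 1) (2 * k - β)) : α ≤ 1 ∨ β ≤ 1 := by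
  obtain ⟨i, h1, h2, h3⟩ := exists_of_one_le_nbrCount hX
  have := T.closed₁.sub_eq hG (i := 0) (j := i) (by omega) (by omega) h0 h3
  omega

/-- If `v` missed the third spoke's first vertex `h 1`, its second neighbours on `h` and `g` would
be forced to be `h (2k-2)` and `g 3`. A ladder then excludes `2 ≤ α`, another excludes `2 ≤ β`,
against admissibility. -/
theorem one_le_nbrCount_of_adj_one [Fintype V] (T : G.Tetrahedron k f g h α β γ) (hk : 2 ≤ k)
    (hG : G.OddSaturated k) (hdeg : G.DegreesLarge k) (hgood : GoodSpokes α β γ)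
    (h0 : ¬ G.Adj v (f 0)) (h1 : G.Adj v (f 1)) (h2 : G.Adj v (f (2 * k)))
    (hg : 2 ≤ G.nbrCount v g 0 (2 * k)) (hh : 2 ≤ G.nbrCount v h 0 (2 * k)) :
    1 ≤ G.nbrCount v f 1 α ∧ 1 ≤ G.nbrCount v g 1 β ∧ 1 ≤ G.nbrCount v h 1 γ := by
  obtain ⟨hα, hβ, hγ, hαβ, -⟩ := hgood
  have hodd := hG.odd
  have e1 : h (2 * k) = f 1 := (T.spoke₁ 1 hα).symm
  have e2 : g 1 = f (2 * k) := T.spoke₂ 1 hβ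
  have e3 : h 1 = g (2 * k) := T.spoke₃ 1 hγ
  refine ⟨one_le_nbrCount 1 h1 le_rfl hα, one_le_nbrCount 1 (e2 ▸ h2) le_rfl hβ, ?_⟩
  suffices G.Adj v (h 1) from one_le_nbrCount 1 this le_rfl hγ
  by_contra hcon
  have hh3 : G.Adj v (h (2 * k - 2)) := by
    obtain ⟨i, j, -, hij, hj, ai, aj⟩ := exists_of_two_le_nbrCount hh
    have a2k : G.Adj v (h (2 * k)) := e1 ▸ h1
    rcases eq_or_lt_of_le hj with rfl | hj
    · have := T.closed₃.sub_eq hodd hij le_rfl ai a2k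
      rcases this with h | h
      · rwa [show 2 * k - 2 = i by omega]
      · rw [show i = 1 by omega] at ai
        exact absurd ai hcon
    · exact (T.closed₃.not_adj_three hk hodd hij hj le_rfl ai aj a2k).elim
  have hg3 : G.Adj v (g 3) := by
    obtain ⟨i, j, -, hij, hj, ai, aj⟩ := exists_of_two_le_nbrCount hg
    have a1 : G.Adj v (g 1) := e2 ▸ h2
    have hi : i ≠ 0 := by
      rintro rfl
      rw [T.zero₂] at ai
      exact h0 ai
    rcases eq_or_ne i 1 with rfl | hi1
    · have := T.closed₂.sub_eq hodd hij hj a1 aj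
      rcases this with h | h
      · rwa [h] at aj
      · rw [h, show 1 + (2 * k - 1) = 2 * k by omega, ← e3] at aj
        exact absurd aj hcon
    · exact (T.closed₂.not_adj_three hk hodd (show 1 < i by omega) hij hj a1 ai aj).elim
  have f01 := T.closed₁.adj 0 (by omega)
  have f2k : G.Adj (f (2 * k)) (f 0) := T.closed₁.closed ▸ T.closed₁.adj (2 * k) (by omega)
  have hα1 : α ≤ 1 := by
    by_contra! hc
    have e4 : h (2 * k - 1) = f 2 := (T.spoke₁ 2 hc).symm
    have a := T.closed₃.adj (2 * k - 2) (by omega)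
    rw [show 2 * k - 2 + 1 = 2 * k - 1 by omega, e4] at a
    rcases hG.adj_of_ladder hk hdeg h2.symm hh3 f01 (T.closed₁.adj 1 (by omega)) f2k h1 a with b | b
    · have := hodd.le_add b.symm.reachIn
        (T.closed₁.reachIn (i := 2) (j := 2 * k) (by omega) (by omega))
      omega
    · rw [← T.zero₃] at b
      have := hodd.le_add b.symm.reachIn
        (T.closed₃.reachIn (i := 0) (j := 2 * k - 2) (by omega) (by omega))
      omega
  have hβ1 : β ≤ 1 := by
    by_contra! hc
    have e4 : g 2 = f (2 * k - 1) := T.spoke₂ 2 hc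
    have b0 := T.closed₂.adj 0 (by omega)
    have b1 := T.closed₂.adj 1 (by omega)
    have b2 := T.closed₂.adj 2 (by omega)
    rw [T.zero₂] at b0
    rcases hG.adj_of_ladder hk hdeg h1.symm hg3 b0 b1 f01.symm (e2 ▸ h2) b2.symm with b | b
    · rw [e4] at b
      have := hodd.le_add b.reachIn
        (T.closed₁.reachIn (i := 1) (j := 2 * k - 1) (by omega) (by omega))
      omega
    · rw [← T.zero₂] at b
      have := hodd.le_add b.symm.reachIn
        (T.closed₂.reachIn_around (i := 0) (j := 3) (by omega) (by omega))
      omega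
  omega

/-- If each face visits two neighbours of `v`, then the tetrahedron visits at most three: the
terms count them at the common vertex, on the spokes and on the three remaining arcs. -/
theorem le_three_of_tight [Fintype V] (T : G.Tetrahedron k f g h α β γ) (hk : 2 ≤ k)
    (hG : G.OddSaturated k) (hdeg : G.DegreesLarge k) (hgood : GoodSpokes α β γ)
    (hf : 2 ≤ G.nbrCount v f 0 (2 * k))
    (hg : 2 ≤ G.nbrCount v g 0 (2 * k)) (hh : 2 ≤ G.nbrCount v h 0 (2 * k)) :
    G.nbrCount v f 0 0 +
      (G.nbrCount v f 1 α + G.nbrCount v g 1 β + G.nbrCount v h 1 γ) +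
      (G.nbrCount v f (α + 1) (2 * k - β) + G.nbrCount v g (β + 1) (2 * k - γ) +
        G.nbrCount v h (γ + 1) (2 * k - α)) ≤ 3 := by
  have hodd := hG.odd
  have hgood' := hgood
  obtain ⟨hα, hβ, hγ, hαβ, hβγ, hαγ⟩ := hgood
  -- With `O`, `S`, `X` the counts at the common vertex, on the spokes and on the arcs, summing over
  -- the faces gives `3O + 2S + X = 6`, so the total is `6 - 2O - S`. It remains to treat `O = 1, S
  -- = 0` and `O = 0, S ≤ 2`.
  have cf := T.nbrCount_eq (T.add_le hodd hα hγ) v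
  have cg := T.rotate.nbrCount_eq (T.rotate.add_le hodd hβ hα) v
  have ch := T.rotate.rotate.nbrCount_eq (T.rotate.rotate.add_le hodd hγ hβ) v
  have lf := T.closed₁.nbrCount_le_two hk hodd v
  have lg := T.closed₂.nbrCount_le_two hk hodd v
  have lh := T.closed₃.nbrCount_le_two hk hodd v
  have og : G.nbrCount v g 0 0 = G.nbrCount v f 0 0 :=
    nbrCount_congr fun i _ hi ↦ by rw [Nat.le_zero.1 hi, T.zero₂]
  have oh : G.nbrCount v h 0 0 = G.nbrCount v f 0 0 :=
    nbrCount_congr fun i _ hi ↦ by rw [Nat.le_zero.1 hi, T.zero₃]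
  by_cases h0 : G.Adj v (f 0)
  · have := one_le_nbrCount (a := 0) (b := 0) 0 h0 le_rfl le_rfl
    by_contra! hcon
    have b1 := T.le_one_of_adj_center hodd h0
    have b2 := T.rotate.le_one_of_adj_center hodd (T.zero₂ ▸ h0)
    have b3 := T.rotate.rotate.le_one_of_adj_center hodd (T.zero₃ ▸ h0)
    omega
  · have g0 : ¬ G.Adj v (g 0) := T.zero₂ ▸ h0
    have h0' : ¬ G.Adj v (h 0) := T.zero₃ ▸ h0
    rcases T.closed₁.exists_center hodd h0 hf with ⟨d, d1, d2, d3, d4⟩ | ⟨d1, d2⟩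
    · rcases T.closed₂.exists_center hodd g0 hg with ⟨e, e1, e2, e3, e4⟩ | ⟨e1, e2⟩
      · rcases T.closed₃.exists_center hodd h0' hh with ⟨c, c1, c2, c3, c4⟩ | ⟨c1, c2⟩
        -- The three centres would sum pairwise to `2k+1`, forcing `2d = 2k+1`.
        · have := T.closed₁.center_add hodd T.closed₃ T.zero₃ (T.spoke₁ 1 hα).symm
            d1 d2 c1 c2 d3 d4 c3 c4
          have := T.closed₂.center_add hodd T.closed₁ T.zero₂.symm (T.spoke₂ 1 hβ).symm
            e1 e2 d1 d2 e3 e4 d3 d4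
          have := T.closed₃.center_add hodd T.closed₂ T.rotate.zero₂.symm (T.spoke₃ 1 hγ).symm
            c1 c2 e1 e2 c3 c4 e3 e4
          omega
        · have := T.rotate.rotate.one_le_nbrCount_of_adj_one hk hG hdeg ⟨by omega, by omega, by omega,
            by omega, by omega, by omega⟩ h0' c1 c2 hf hg
          omega
      · have := T.rotate.one_le_nbrCount_of_adj_one hk hG hdeg ⟨by omega, by omega, by omega,
          by omega, by omega, by omega⟩ g0 e1 e2 hh hf
        omega
    · have := T.one_le_nbrCount_of_adj_one hk hG hdeg hgood' h0 d1 d2 hg hh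
      omega

/-- Here `v` is a twin of the end `f α` of the first spoke. Putting `v` in its place keeps the first
spoke, and the edge from `v` to `g j` then lets the second spoke grow from `β` to `j`. -/
theorem hasTetrahedron_of_twin (T : G.Tetrahedron k f g h α β γ) (hgood : GoodSpokes α β γ)
    (hγ : α + γ ≤ 2 * k) (h1 : G.Adj v (f (α - 1)))
    (h2 : G.Adj v (f (α + 1))) (h3 : G.Adj v (h (2 * k - α))) {j : ℕ} (hj : α + j = 2 * k)
    (hjβ : β < j) (hvj : G.Adj v (g j)) : G.HasTetrahedron k (α + β + γ + 1) := by
  obtain ⟨a1, a2, a3, a4, a5, a6⟩ := hgood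
  have T1 := ((T.mono (Nat.sub_le α 1) le_rfl le_rfl).update a1 (by omega) h1 h2 (by omega)
    (by omega)).fold (d := α) (by omega) (by rwa [Function.update_self]) (by omega)
  have T2 := T1.rotate.fold (d := j) (by omega)
    (by rw [show 2 * k - j = α by omega, Function.update_self]; exact hvj.symm) (by omega)
  exact ⟨_, _, _, _, _, _, T2, ⟨by omega, by omega, by omega, by omega, by omega, by omega⟩,
    by omega⟩

/-- The common centre `d` of both faces is compared with `α`. Below it, two neighbours lie on the
spoke, contrary to `hs`; at it, `v` is a twin of the spoke's end; beyond it, the spoke is extended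
to `v` at `d`, if necessary shortening another spoke by one. -/
theorem hasTetrahedron_of_two_faces (T : G.Tetrahedron k f g h α β γ) (hk : 2 ≤ k)
    (hG : G.OddClosedWalksAtLeast (2 * k + 1)) (hgood : GoodSpokes α β γ) (h0 : ¬ G.Adj v (f 0))
    (hf : 2 ≤ G.nbrCount v f 0 (2 * k)) (hh : 2 ≤ G.nbrCount v h 0 (2 * k))
    (hs : G.nbrCount v f 1 α + G.nbrCount v g 1 β + G.nbrCount v h 1 γ ≤ 1)
    (ht : 4 ≤ (G.nbrCount v f 1 α + G.nbrCount v g 1 β + G.nbrCount v h 1 γ) +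
      (G.nbrCount v f (α + 1) (2 * k - β) + G.nbrCount v g (β + 1) (2 * k - γ) +
        G.nbrCount v h (γ + 1) (2 * k - α))) :
    G.HasTetrahedron k (α + β + γ + 1) := by
  have hgood' := hgood
  obtain ⟨hα, hβ, hγ, hαβ, hβγ, hαγ⟩ := hgood
  have e1 := T.add_le hG hα hγ
  have e2 := T.rotate.add_le hG hβ hα
  have e3 := T.rotate.rotate.add_le hG hγ hβ
  have cf := T.nbrCount_eq e1 v
  have ch := T.rotate.rotate.nbrCount_eq e3 v
  have lf := T.closed₁.nbrCount_le_two hk hG v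
  have lh := T.closed₃.nbrCount_le_two hk hG v
  have g1 : g 1 = f (2 * k) := T.spoke₂ 1 hβ
  have h1 : h 1 = g (2 * k) := T.spoke₃ 1 hγ
  have f1 : f 1 = h (2 * k) := T.spoke₁ 1 hα
  obtain ⟨d, d1, d2, d3, d4⟩ | ⟨d1, d2⟩ := T.closed₁.exists_center hG h0 hf
  swap
  · have := one_le_nbrCount (a := 1) (b := α) 1 d1 le_rfl hα
    have := one_le_nbrCount (a := 1) (b := β) 1 (g1 ▸ d2) le_rfl hβ
    omega
  obtain ⟨e, c1, c2, c3, c4⟩ | ⟨c1, c2⟩ := T.closed₃.exists_center hG (T.zero₃ ▸ h0) hh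
  swap
  · have := one_le_nbrCount (a := 1) (b := γ) 1 c1 le_rfl hγ
    have := one_le_nbrCount (a := 1) (b := α) 1 (f1 ▸ c2) le_rfl hα
    omega
  have hde := T.closed₁.center_add hG T.closed₃ T.zero₃ f1.symm d1 d2 c1 c2 d3 d4 c3 c4
  obtain rfl : e = 2 * k + 1 - d := by omega
  rw [show 2 * k + 1 - d - 1 = 2 * k - d by omega] at c3
  rw [show 2 * k + 1 - d + 1 = 2 * k + 2 - d by omega] at c4
  have key : ∀ β' γ', β' ≤ β → γ' ≤ γ → β' + d ≤ 2 * k → γ' + d ≤ 2 * k →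
      GoodSpokes d β' γ' → α + β + γ < d + β' + γ' → G.HasTetrahedron k (α + β + γ + 1) := by
    intro β' γ' b1 b2 b3 b4 b5 b6
    have T1 := ((T.mono (Nat.zero_le α) b1 b2).update (by omega) (by omega) d3 d4 (by omega)
      b3).fold (d := d) (by omega) (by rwa [Function.update_self]) b4
    exact ⟨_, _, _, _, _, _, T1, b5, b6⟩
  have spokeβ : ∀ i, 1 ≤ i → i ≤ β → G.Adj v (f (2 * k + 1 - i)) → G.Adj v (g i) :=
    fun i _ hi ha ↦ T.spoke₂ i hi ▸ ha
  rcases lt_trichotomy d α with hlt | rfl | hgt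
  · have := two_le_nbrCount (a := 1) (b := α) (d - 1) (d + 1) d3 d4 (by omega) (by omega) (by omega)
    omega
  · have := one_le_nbrCount (a := 1) (b := d) (d - 1) d3 (by omega) (by omega)
    obtain ⟨j, j1, j2, j3⟩ :=
      exists_of_one_le_nbrCount (show 1 ≤ G.nbrCount v g (β + 1) (2 * k - γ) by omega)
    have a1 := (T.closed₁.reachIn (i := 0) (j := d - 1) (by omega) (by omega)).trans
      d3.symm.reachIn
    have a2 := (T.closed₁.reachIn (i := d + 1) (j := 2 * k) (by omega) (by omega)).symm.trans
      d4.symm.reachIn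
    have a3 := (T.closed₃.reachIn (i := 1) (j := 2 * k - d) (by omega) (by omega)).trans
      c3.symm.reachIn
    have b1 := (T.closed₂.reachIn (i := 0) (j := j) (by omega) (by omega)).trans j3.symm.reachIn
    have b2 := (T.closed₂.reachIn_around (i := 0) (j := j) (by omega) (by omega)).trans
      j3.symm.reachIn
    have b3 := (T.closed₂.reachIn (i := 1) (j := j) (by omega) (by omega)).trans j3.symm.reachIn
    have b4 := (T.closed₂.reachIn (i := j) (j := 2 * k) (by omega) (by omega)).symm.trans
      j3.symm.reachIn
    rw [T.zero₂] at b1 b2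
    rw [g1] at b3
    rw [h1] at a3
    have p1 := hG.le_add a1 b1
    have p2 := hG.le_add a1 b2
    have p3 := hG.le_add a2 b3
    have p4 := hG.le_add a3 b4
    have hj : d + j = 2 * k ∨ d + (2 * k + 1 - j) = 2 * k := by omega
    rcases hj with hj | hj
    · exact T.hasTetrahedron_of_twin hgood' (by omega) d3 d4 c3 hj (by omega) j3
    · have := T.reflect.hasTetrahedron_of_twin (v := v) (j := 2 * k + 1 - j)
        ⟨by omega, by omega, by omega, by omega, by omega, by omega⟩ (by omega)
        (by rwa [show 2 * k + 1 - (d - 1) = 2 * k + 2 - d by omega])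
        (by rwa [show 2 * k + 1 - (d + 1) = 2 * k - d by omega])
        (by rwa [show 2 * k + 1 - (2 * k - d) = d + 1 by omega]) hj (by omega)
        (by rwa [show 2 * k + 1 - (2 * k + 1 - j) = j by omega])
      rwa [add_right_comm d] at this
  · rcases lt_trichotomy (d + β) (2 * k + 1) with hb | hb | hb
    · rcases lt_trichotomy (d + γ) (2 * k + 1) with hc | hc | hc
      · exact key β γ le_rfl le_rfl (by omega) (by omega)
          ⟨by omega, by omega, by omega, by omega, by omega, by omega⟩ (by omega)
      · have := one_le_nbrCount (a := 1) (b := γ) (2 * k - d) c3 (by omega) (by omega)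
        have : d - 1 ≠ α := by
          rintro e
          have := one_le_nbrCount (a := 1) (b := α) (d - 1) d3 (by omega) (by omega)
          omega
        have : ¬ 2 * k + 1 - (d + 1) ≤ β := by
          intro e
          have := one_le_nbrCount (a := 1) (b := β) (2 * k + 1 - (d + 1))
            (spokeβ _ (by omega) e (by rwa [show 2 * k + 1 - (2 * k + 1 - (d + 1)) = d + 1 by omega]))
            (by omega) (by omega)
          omega
        -- The loss of one on `γ` is outweighed because `d - 1 ≠ α` gives `d ≥ α + 2`.
        exact key β (γ - 1) le_rfl (by omega) (by omega) (by omega)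
          ⟨by omega, by omega, by omega, by omega, by omega, by omega⟩ (by omega)
      · have := two_le_nbrCount (a := 1) (b := γ) (2 * k - d) (2 * k + 2 - d) c3 c4
          (by omega) (by omega) (by omega)
        omega
    · have := one_le_nbrCount (a := 1) (b := β) (2 * k + 1 - (d + 1))
        (spokeβ _ (by omega) (by omega)
          (by rwa [show 2 * k + 1 - (2 * k + 1 - (d + 1)) = d + 1 by omega])) (by omega) (by omega)
      have : d - 1 ≠ α := by
        rintro e
        have := one_le_nbrCount (a := 1) (b := α) (d - 1) d3 (by omega) (by omega)
        omega
      have : ¬ 2 * k - d ≤ γ := by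
        intro e
        have := one_le_nbrCount (a := 1) (b := γ) (2 * k - d) c3 (by omega) (by omega)
        omega
      exact key (β - 1) γ (by omega) le_rfl (by omega) (by omega)
        ⟨by omega, by omega, by omega, by omega, by omega, by omega⟩ (by omega)
    · have := two_le_nbrCount (a := 1) (b := β) (2 * k + 1 - (d + 1)) (2 * k + 1 - (d - 1))
        (spokeβ _ (by omega) (by omega)
          (by rwa [show 2 * k + 1 - (2 * k + 1 - (d + 1)) = d + 1 by omega]))
        (spokeβ _ (by omega) (by omega)
          (by rwa [show 2 * k + 1 - (2 * k + 1 - (d - 1)) = d - 1 by omega]))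
        (by omega) (by omega) (by omega)
      omega

theorem hasTetrahedron_of_arc_of_two_le (T : G.Tetrahedron k f g h α β γ)
    (hG : G.OddClosedWalksAtLeast (2 * k + 1)) (hgood : GoodSpokes α β γ) (hα : 2 ≤ α)
    {d j : ℕ} (hd : α + 2 ≤ d) (hd' : d + 1 + β ≤ 2 * k) (h1 : G.Adj v (f (d - 1)))
    (h2 : G.Adj v (f (d + 1))) (hj : γ + 1 ≤ j) (hj' : j + α ≤ 2 * k) (h3 : G.Adj v (h j)) :
    G.HasTetrahedron k (α + β + γ + 1) := by
  obtain ⟨-, hβ, hγ, hαβ, hβγ, hαγ⟩ := hgood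
  have a1 := (T.closed₁.reachIn (i := α) (j := d - 1) (by omega) (by omega)).trans h1.symm.reachIn
  have a2 := (T.closed₁.reachIn (i := 0) (j := d - 1) (by omega) (by omega)).trans h1.symm.reachIn
  have a3 := (T.closed₁.reachIn_around (i := 0) (j := d + 1) (by omega) (by omega)).trans
    h2.symm.reachIn
  have b1 := (T.closed₃.reachIn (i := j) (j := 2 * k + 1 - α) (by omega) (by omega)).symm.trans
    h3.symm.reachIn
  have b2 := (T.closed₃.reachIn (i := 0) (j := j) (by omega) (by omega)).trans h3.symm.reachIn
  have b3 := (T.closed₃.reachIn_around (i := 0) (j := j) (by omega) (by omega)).trans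
    h3.symm.reachIn
  rw [← T.spoke₁ α le_rfl] at b1
  rw [T.zero₃] at b2 b3
  have p1 := hG.le_add a1 b1
  have p2 := hG.le_add a3 b2
  have p3 := hG.le_add a2 b2
  have p4 := hG.le_add a3 b3
  have T1 := T.update (v := v) (d := d) (by omega) (by omega) h1 h2 (by omega) (by omega)
  -- The other parity of `d + j` is ruled out by `p1` and `p2`, and this is where `2 ≤ α` matters.
  -- In the first case the spoke `α` is prolonged along `f` to `v`; in the second it follows `h` to
  -- `h j`, reaching length `d - 1`.
  obtain hj | hj : j = 2 * k - d ∨ j = 2 * k + 2 - d := by omega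
  · have T2 := T1.fold (d := d) (by omega) (by rw [Function.update_self, ← hj]; exact h3)
      (by omega)
    exact ⟨_, _, _, _, _, _, T2, ⟨by omega, by omega, by omega, by omega, by omega, by omega⟩,
      by omega⟩
  · have T2 := T1.reflect.fold (d := d - 1) (by omega)
      (by
        rw [show 2 * k + 1 - (d - 1) = j by omega, show 2 * k + 1 - (2 * k - (d - 1)) = d by omega,
          Function.update_self]
        exact h3.symm) (by omega)
    exact ⟨_, _, _, _, _, _, T2, ⟨by omega, by omega, by omega, by omega, by omega, by omega⟩,
      by omega⟩

theorem hasTetrahedron_of_arc (T : G.Tetrahedron k f g h α β γ)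
    (hG : G.OddClosedWalksAtLeast (2 * k + 1)) (hgood : GoodSpokes α β γ)
    (hX : 2 ≤ G.nbrCount v f (α + 1) (2 * k - β)) (hY : 1 ≤ G.nbrCount v g (β + 1) (2 * k - γ))
    (hZ : 1 ≤ G.nbrCount v h (γ + 1) (2 * k - α)) : G.HasTetrahedron k (α + β + γ + 1) := by
  have hgood' := hgood
  obtain ⟨hα, hβ, hγ, hαβ, hβγ, hαγ⟩ := hgood
  obtain ⟨i, i', i1, i2, i3, i4, i5⟩ := exists_of_two_le_nbrCount hX
  obtain ⟨j, j1, j2, j3⟩ := exists_of_one_le_nbrCount hY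
  obtain ⟨l, l1, l2, l3⟩ := exists_of_one_le_nbrCount hZ
  obtain rfl : i' = i + 2 := by
    have := T.closed₁.sub_eq hG i2 (by omega) i4 i5
    omega
  by_cases h2 : 2 ≤ α
  · exact T.hasTetrahedron_of_arc_of_two_le hG hgood' h2 (d := i + 1) (by omega) (by omega)
      (by simpa using i4) (by simpa using i5) l1 (by omega) l3
  -- If `α = 1` then `β ≥ 2`, and this symmetry swaps the two spokes of the face `f`.
  · have := T.reflect.rotate.rotate.hasTetrahedron_of_arc_of_two_le (v := v) hG
      ⟨by omega, by omega, by omega, by omega, by omega, by omega⟩ (by omega)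
      (d := 2 * k + 1 - (i + 1)) (j := 2 * k + 1 - j) (by omega) (by omega)
      (by rwa [show 2 * k + 1 - (2 * k + 1 - (i + 1) - 1) = i + 2 by omega])
      (by rwa [show 2 * k + 1 - (2 * k + 1 - (i + 1) + 1) = i by omega]) (by omega) (by omega)
      (by rwa [show 2 * k + 1 - (2 * k + 1 - j) = j by omega])
    rwa [add_comm β α] at this

/-- Each face is seen at most twice. Since `le_three_of_tight` excludes three faces seen twice,
nothing is seen at the common vertex and at most one neighbour lies on the spokes. What remains is
two faces seen twice, or arcs seen 2, 1 and 1 times. -/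
theorem hasTetrahedron_of_four_le [Fintype V] (T : G.Tetrahedron k f g h α β γ) (hk : 2 ≤ k)
    (hG : G.OddSaturated k) (hdeg : G.DegreesLarge k) (hgood : GoodSpokes α β γ)
    (ht : 4 ≤ G.nbrCount v f 0 0 +
      (G.nbrCount v f 1 α + G.nbrCount v g 1 β + G.nbrCount v h 1 γ) +
      (G.nbrCount v f (α + 1) (2 * k - β) + G.nbrCount v g (β + 1) (2 * k - γ) +
        G.nbrCount v h (γ + 1) (2 * k - α))) :
    G.HasTetrahedron k (α + β + γ + 1) := by
  have hodd := hG.odd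
  have tight := fun a b c ↦ (T.le_three_of_tight hk hG hdeg hgood (v := v) a b c)
  have hgood' := hgood
  obtain ⟨hα, hβ, hγ, hαβ, hβγ, hαγ⟩ := hgood
  have cf := T.nbrCount_eq (T.add_le hodd hα hγ) v
  have cg := T.rotate.nbrCount_eq (T.rotate.add_le hodd hβ hα) v
  have ch := T.rotate.rotate.nbrCount_eq (T.rotate.rotate.add_le hodd hγ hβ) v
  have lf := T.closed₁.nbrCount_le_two hk hodd v
  have lg := T.closed₂.nbrCount_le_two hk hodd v
  have lh := T.closed₃.nbrCount_le_two hk hodd v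
  have og : G.nbrCount v g 0 0 = G.nbrCount v f 0 0 :=
    nbrCount_congr fun i _ hi ↦ by rw [Nat.le_zero.1 hi, T.zero₂]
  have oh : G.nbrCount v h 0 0 = G.nbrCount v f 0 0 :=
    nbrCount_congr fun i _ hi ↦ by rw [Nat.le_zero.1 hi, T.zero₃]
  have good1 : GoodSpokes β γ α := ⟨hβ, hγ, hα, hβγ, by omega, by omega⟩
  have good2 : GoodSpokes γ α β := ⟨hγ, hα, hβ, by omega, by omega, by omega⟩
  have hO : G.nbrCount v f 0 0 = 0 := by omega
  have h0 : ¬ G.Adj v (f 0) := fun ha ↦ by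
    have := one_le_nbrCount (a := 0) (b := 0) 0 ha le_rfl le_rfl
    omega
  have s1 : β + γ + α + 1 = α + β + γ + 1 := by omega
  have s2 : γ + α + β + 1 = α + β + γ + 1 := by omega
  by_cases c1 : 2 ≤ G.nbrCount v f 0 (2 * k) ∧ 2 ≤ G.nbrCount v h 0 (2 * k)
  · exact T.hasTetrahedron_of_two_faces hk hodd hgood' h0 c1.1 c1.2 (by omega) (by omega)
  by_cases c2 : 2 ≤ G.nbrCount v g 0 (2 * k) ∧ 2 ≤ G.nbrCount v f 0 (2 * k)
  · exact s1 ▸ T.rotate.hasTetrahedron_of_two_faces hk hodd good1 (T.zero₂ ▸ h0) c2.1 c2.2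
      (by omega) (by omega)
  by_cases c3 : 2 ≤ G.nbrCount v h 0 (2 * k) ∧ 2 ≤ G.nbrCount v g 0 (2 * k)
  · exact s2 ▸ T.rotate.rotate.hasTetrahedron_of_two_faces hk hodd good2 (T.zero₃ ▸ h0) c3.1 c3.2
      (by omega) (by omega)
  by_cases d1 : 2 ≤ G.nbrCount v f 0 (2 * k)
  · exact T.hasTetrahedron_of_arc hodd hgood' (v := v) (by omega) (by omega) (by omega)
  by_cases d2 : 2 ≤ G.nbrCount v g 0 (2 * k)
  · exact s1 ▸ T.rotate.hasTetrahedron_of_arc hodd good1 (v := v) (by omega) (by omega) (by omega)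
  · exact s2 ▸ T.rotate.rotate.hasTetrahedron_of_arc hodd good2 (v := v) (by omega) (by omega)
      (by omega)

end Tetrahedron

theorem HasTetrahedron.succ [Fintype V] (hk : 2 ≤ k) (hG : G.OddSaturated k)
    (hdeg : G.DegreesLarge k) {m : ℕ} (hm : G.HasTetrahedron k m) :
    G.HasTetrahedron k (m + 1) := by
  obtain ⟨f, g, h, α, β, γ, T, hgood, hle⟩ := hm
  have hgood' := hgood
  obtain ⟨hα, hβ, hγ, hαβ, hβγ, hαγ⟩ := hgood
  have hodd := hG.odd
  have e0 := T.sum_le hodd hgood'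
  have e1 := T.add_le hodd hα hγ
  have e2 := T.rotate.add_le hodd hβ hα
  have e3 := T.rotate.rotate.add_le hodd hγ hβ
  suffices G.HasTetrahedron k (α + β + γ + 1) by
    obtain ⟨f', g', h', α', β', γ', T', hg, hl⟩ := this
    exact ⟨f', g', h', α', β', γ', T', hg, by omega⟩
  by_contra hcon
  have hsum := Finset.sum_le_card_nsmul Finset.univ _ 3 fun v _ ↦
    Nat.lt_succ_iff.1 (lt_of_not_ge fun ht ↦
      hcon (T.hasTetrahedron_of_four_le (v := v) hk hG hdeg hgood' ht))
  simp only [Finset.sum_add_distrib, smul_eq_mul, Finset.card_univ] at hsum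
  have s0 := hdeg.le_sum_nbrCount f 0 0
  have s1 := hdeg.le_sum_nbrCount f 1 α
  have s2 := hdeg.le_sum_nbrCount g 1 β
  have s3 := hdeg.le_sum_nbrCount h 1 γ
  have s4 := hdeg.le_sum_nbrCount f (α + 1) (2 * k - β)
  have s5 := hdeg.le_sum_nbrCount g (β + 1) (2 * k - γ)
  have s6 := hdeg.le_sum_nbrCount h (γ + 1) (2 * k - α)
  -- The tetrahedron has `6k + 1 - (α+β+γ)` positions, at least `4k` by `e0`.
  have total : 4 * k ≤ (0 + 1 - 0) + ((α + 1 - 1) + (β + 1 - 1) + (γ + 1 - 1)) +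
      ((2 * k - β + 1 - (α + 1)) + (2 * k - γ + 1 - (β + 1)) + (2 * k - α + 1 - (γ + 1))) := by
    omega
  have lower := Nat.mul_le_mul_right (3 * Fintype.card V + 1) total
  have upper := Nat.mul_le_mul_left (4 * k) hsum
  simp only [add_mul, mul_add] at lower upper s0 s1 s2 s3 s4 s5 s6
  linarith

theorem OddSaturated.not_hasTetrahedron [Fintype V] (hk : 2 ≤ k) (hG : G.OddSaturated k)
    (hdeg : G.DegreesLarge k) : ¬ G.HasTetrahedron k 0 := by
  intro h0
  have hall : ∀ m, G.HasTetrahedron k m := fun m ↦ by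
    induction m with
    | zero => exact h0
    | succ m ih => exact ih.succ hk hG hdeg
  obtain ⟨f, g, h, α, β, γ, T, hgood, hle⟩ := hall (2 * k + 2)
  have := T.sum_le hG.odd hgood
  omega

end Tetrahedra

end SimpleGraph

namespace SimpleGraph

/-! ### Attaching every vertex to a fixed closed walk of length `2k+1`. -/

section CycleColouring

variable {V : Type*} {G : SimpleGraph V} {k : ℕ}

theorem OddSaturated.adj_two_or_adj_sub [Fintype V] (hk : 2 ≤ k) (hG : G.OddSaturated k)
    (hdeg : G.DegreesLarge k) {f : ℕ → V} (hf : G.ClosedSeq (2 * k + 1) f) {x : V}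
    (hx : G.Adj x (f 0)) : G.Adj x (f 2) ∨ G.Adj x (f (2 * k - 1)) := by
  by_contra! hcon
  obtain ⟨p, hp0, hpe, hp⟩ := (hG.reach _ _ hcon.1).exists_seq
  obtain ⟨q, hq0, hqe, hq⟩ := (hG.reach _ _ hcon.2).symm.exists_seq
  have f01 := hf.adj 0 (by omega)
  have f12 := hf.adj 1 (by omega)
  have fk := hf.adj (2 * k - 1) (by omega)
  have f2k := hf.adj (2 * k) (by omega)
  rw [hf.closed] at f2k
  rw [show 2 * k - 1 + 1 = 2 * k by omega] at fk
  -- The tetrahedron is centred at `f 0`, with spokes `f 0, f 1, f 2`, then `f 0, f (2k), f (2k-1)`,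
  -- then `f 0, x`; the walks `p` and `q` are the two arcs ending at `x`.
  refine hG.not_hasTetrahedron hk hdeg ⟨f,
    fun i ↦ if i = 0 then f 0 else if i = 1 then f (2 * k) else if i ≤ 2 * k then q (i - 2) else f 0,
    fun i ↦ if i = 0 then f 0 else if i ≤ 2 * k - 1 then p (i - 1) else
      if i = 2 * k then f 1 else f 0, 2, 2, 1, ⟨hf, ⟨?_, fun i hi ↦ ?_⟩, ⟨?_, fun i hi ↦ ?_⟩,
      by omega, by omega, by omega, fun i hi ↦ ?_, fun i hi ↦ ?_, fun i hi ↦ ?_⟩,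
      ⟨by omega, by omega, by omega, by omega, by omega, by omega⟩, by omega⟩
  · rw [if_neg (by omega), if_neg (by omega), if_neg (by omega), if_pos rfl]
  · obtain rfl | rfl | h | rfl : i = 0 ∨ i = 1 ∨ (2 ≤ i ∧ i < 2 * k) ∨ i = 2 * k := by omega
    · simpa using f2k.symm
    · rw [if_neg (by omega), if_pos rfl, if_neg (by omega), if_neg (by omega), if_pos (by omega)]
      simpa [hq0] using fk.symm
    · rw [if_neg (by omega), if_neg (by omega), if_pos (by omega), if_neg (by omega),
        if_neg (by omega), if_pos (by omega), show i + 1 - 2 = i - 2 + 1 by omega]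
      exact hq _ (by omega)
    · rw [if_neg (by omega), if_neg (by omega), if_pos (by omega), if_neg (by omega),
        if_neg (by omega), if_neg (by omega), hqe]
      exact hx
  · rw [if_neg (by omega), if_neg (by omega), if_neg (by omega), if_pos rfl]
  · obtain rfl | h | rfl | rfl : i = 0 ∨ (1 ≤ i ∧ i < 2 * k - 1) ∨ i = 2 * k - 1 ∨ i = 2 * k := by
      omega
    · rw [if_pos rfl, if_neg (by omega), if_pos (by omega)]
      simpa [hp0] using hx.symm
    · rw [if_neg (by omega), if_pos (by omega), if_neg (by omega), if_pos (by omega),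
        show i + 1 - 1 = i - 1 + 1 by omega]
      exact hp _ (by omega)
    · rw [if_neg (by omega), if_pos (by omega), if_neg (by omega), if_neg (by omega),
        if_pos (by omega), show 2 * k - 1 - 1 = 2 * k - 2 by omega, hpe]
      exact f12.symm
    · rw [if_neg (by omega), if_neg (by omega), if_pos rfl, if_neg (by omega), if_neg (by omega),
        if_neg (by omega)]
      exact f01.symm
  · obtain rfl | rfl | rfl : i = 0 ∨ i = 1 ∨ i = 2 := by omega
    · rw [if_neg (by omega), if_neg (by omega), if_neg (by omega)]
    · rw [if_neg (by omega), if_neg (by omega), if_pos (by omega)]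
    · rw [if_neg (by omega), if_pos (by omega), show 2 * k + 1 - 2 - 1 = 2 * k - 2 by omega, hpe]
  · obtain rfl | rfl | rfl : i = 0 ∨ i = 1 ∨ i = 2 := by omega
    · rw [if_pos rfl, Nat.sub_zero, hf.closed]
    · rw [if_neg (by omega), if_pos rfl, Nat.add_sub_cancel]
    · rw [if_neg (by omega), if_neg (by omega), if_pos (by omega), Nat.sub_self, hq0]
      rfl
  · obtain rfl | rfl : i = 0 ∨ i = 1 := by omega
    · rw [if_pos rfl, if_neg (by omega), if_neg (by omega), if_neg (by omega)]
    · rw [if_neg (by omega), if_pos (by omega), Nat.sub_self, hp0, if_neg (by omega),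
        if_neg (by omega), if_pos (by omega), Nat.add_sub_cancel, hqe]

/-- A closed walk of length `2k+1`, indexed cyclically. -/
def CyclicWalk (G : SimpleGraph V) (k : ℕ) (C : ZMod (2 * k + 1) → V) : Prop :=
  ∀ i, G.Adj (C i) (C (i + 1))

theorem zmod_two_mul_add_one_cast : ((2 * k : ℕ) : ZMod (2 * k + 1)) + 1 = 0 := by
  have := ZMod.natCast_self (2 * k + 1)
  push_cast at this ⊢
  exact this

theorem CyclicWalk.closedSeq {C : ZMod (2 * k + 1) → V} (hC : G.CyclicWalk k C)
    (i : ZMod (2 * k + 1)) : G.ClosedSeq (2 * k + 1) fun n ↦ C (i + n) where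
  closed := by simp only [ZMod.natCast_self, Nat.cast_zero]
  adj n _ := by
    have := hC (i + n)
    rwa [add_assoc, ← Nat.cast_succ] at this

theorem ClosedSeq.exists_cyclicWalk {f : ℕ → V} (hf : G.ClosedSeq (2 * k + 1) f) :
    ∃ C, G.CyclicWalk k C := by
  refine ⟨fun i ↦ f i.val, fun i ↦ ?_⟩
  have hlt := i.val_lt
  have h := hf.adj i.val hlt
  rcases eq_or_lt_of_le (Nat.lt_succ_iff.1 hlt) with e | e
  · have hi : i + 1 = 0 := by
      rw [← ZMod.natCast_zmod_val i, e]
      exact zmod_two_mul_add_one_cast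
    simp only [hi, ZMod.val_zero, e]
    rw [← hf.closed]
    rwa [e] at h
  · have hi : (i + 1).val = i.val + 1 := by
      rw [← ZMod.natCast_zmod_val i, ← Nat.cast_succ, ZMod.val_natCast_of_lt (by omega),
        ZMod.val_natCast_of_lt hlt]
    simpa only [hi] using h

theorem exists_natCast_add (i j : ZMod (2 * k + 1)) : ∃ n : ℕ, n ≤ 2 * k ∧ j = i + n :=
  ⟨(j - i).val, Nat.lt_succ_iff.1 (ZMod.val_lt _), by rw [ZMod.natCast_zmod_val]; ring⟩

theorem CyclicWalk.not_adj_three {C : ZMod (2 * k + 1) → V} (hk : 2 ≤ k)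
    (hG : G.OddClosedWalksAtLeast (2 * k + 1)) (hC : G.CyclicWalk k C) {v : V}
    {i j l : ZMod (2 * k + 1)} (hij : i ≠ j) (hil : i ≠ l) (hjl : j ≠ l) (hi : G.Adj v (C i))
    (hj : G.Adj v (C j)) (hl : G.Adj v (C l)) : False := by
  obtain ⟨m, hm, rfl⟩ := exists_natCast_add i j
  obtain ⟨n, hn, rfl⟩ := exists_natCast_add i l
  have hm0 : m ≠ 0 := by rintro rfl; simp at hij
  have hn0 : n ≠ 0 := by rintro rfl; simp at hil
  have hi' : G.Adj v (C (i + (0 : ℕ))) := by simpa using hi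
  rcases lt_trichotomy m n with h | rfl | h
  · exact (hC.closedSeq i).not_adj_three hk hG (show 0 < m by omega) h hn hi' hj hl
  · exact hjl rfl
  · exact (hC.closedSeq i).not_adj_three hk hG (show 0 < n by omega) h hm hi' hl hj

theorem natCast_zmod_ne_zero {m : ℕ} (h0 : m ≠ 0) (hm : m < 2 * k + 1) :
    (m : ZMod (2 * k + 1)) ≠ 0 := by
  intro h
  exact h0 (Nat.eq_zero_of_dvd_of_lt ((ZMod.natCast_eq_zero_iff _ _).1 h) hm)

open Classical in
theorem CyclicWalk.update {C : ZMod (2 * k + 1) → V} (hk : 2 ≤ k) (hC : G.CyclicWalk k C) {v : V}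
    {i : ZMod (2 * k + 1)} (h1 : G.Adj v (C (i - 1))) (h2 : G.Adj v (C (i + 1))) :
    G.CyclicWalk k (Function.update C i v) := by
  have h01 : (1 : ZMod (2 * k + 1)) ≠ 0 := by
    exact_mod_cast natCast_zmod_ne_zero (k := k) one_ne_zero (by omega)
  intro j
  by_cases e : j = i
  · subst e
    rwa [Function.update_self, Function.update_of_ne (by simpa using h01)]
  by_cases e' : j + 1 = i
  · subst e'
    rw [add_sub_cancel_right] at h1
    rw [Function.update_self, Function.update_of_ne e]
    exact h1.symm
  rw [Function.update_of_ne e, Function.update_of_ne e']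
  exact hC j

/-- With `y` put in place of `C i`, the vertex `x` sees `C (i+2)` or `C (i-2)`. A ladder then gives
`x` the neighbour `C i`, its other outcome being a vertex with three neighbours on `C`. -/
theorem OddSaturated.exists_attached_of_adj [Fintype V] (hk : 2 ≤ k) (hG : G.OddSaturated k)
    (hdeg : G.DegreesLarge k) {C : ZMod (2 * k + 1) → V} (hC : G.CyclicWalk k C) {x y : V}
    (hxy : G.Adj x y) {i : ZMod (2 * k + 1)} (h1 : G.Adj y (C (i - 1)))
    (h2 : G.Adj y (C (i + 1))) : ∃ j, G.Adj x (C (j - 1)) ∧ G.Adj x (C (j + 1)) := by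
  classical
  have n1 : (1 : ZMod (2 * k + 1)) ≠ 0 := by
    exact_mod_cast natCast_zmod_ne_zero (k := k) one_ne_zero (by omega)
  have n2 : (2 : ZMod (2 * k + 1)) ≠ 0 := by
    exact_mod_cast natCast_zmod_ne_zero (k := k) two_ne_zero (by omega)
  have n4 : (4 : ZMod (2 * k + 1)) ≠ 0 := by
    exact_mod_cast natCast_zmod_ne_zero (k := k) four_ne_zero (by omega)
  have hsub : ((2 * k - 1 : ℕ) : ZMod (2 * k + 1)) = -2 := by
    have e : ((2 * k - 1 + 1 : ℕ) : ZMod (2 * k + 1)) = (2 * k : ℕ) :=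
      congrArg _ (Nat.sub_add_cancel (by omega))
    rw [Nat.cast_succ] at e
    linear_combination e + zmod_two_mul_add_one_cast (k := k)
  have hf := (hC.update hk h1 h2).closedSeq i
  have c1 : G.Adj (C (i - 1)) (C i) := by simpa using hC (i - 1)
  have c2 : G.Adj (C i) (C (i + 1)) := hC i
  have c3 : G.Adj (C (i + 1)) (C (i + 2)) := by
    have := hC (i + 1)
    rwa [show i + 1 + 1 = i + 2 by ring] at this
  have c4 : G.Adj (C (i - 2)) (C (i - 1)) := by
    have := hC (i - 2)
    rwa [show i - 2 + 1 = i - 1 by ring] at this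
  rcases hG.adj_two_or_adj_sub hk hdeg hf (x := x) (by simpa using hxy) with h | h
  · rw [Nat.cast_ofNat, Function.update_of_ne (by simpa using n2)] at h
    rcases hG.adj_of_ladder hk hdeg hxy h1 c3.symm c2.symm h h2 c1 with b | b
    · refine ⟨i + 1, by simpa using b, ?_⟩
      rwa [show i + 1 + 1 = i + 2 by ring]
    · refine (hC.not_adj_three hk hG.odd (i := i - 2) (j := i) (l := i + 2) ?_ ?_ ?_
        c4.symm c1 b).elim
      · simpa using n2
      · intro e
        apply n4
        linear_combination -e
      · simpa using n2
  · rw [hsub, ← sub_eq_add_neg, Function.update_of_ne (by simpa using n2)] at h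
    rcases hG.adj_of_ladder hk hdeg hxy h2 c4 c1 h h1 c2.symm with b | b
    · refine ⟨i - 1, ?_, by simpa using b⟩
      rwa [show i - 1 - 1 = i - 2 by ring]
    · refine (hC.not_adj_three hk hG.odd (i := i - 2) (j := i) (l := i + 2) ?_ ?_ ?_
        b c2.symm c3).elim
      · simpa using n2
      · intro e
        apply n4
        linear_combination -e
      · simpa using n2

theorem OddSaturated.exists_attached [Fintype V] (hk : 2 ≤ k) (hG : G.OddSaturated k)
    (hdeg : G.DegreesLarge k) {C : ZMod (2 * k + 1) → V} (hC : G.CyclicWalk k C) (x : V) :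
    ∃ j, G.Adj x (C (j - 1)) ∧ G.Adj x (C (j + 1)) := by
  obtain ⟨p⟩ : Nonempty (G.Walk x (C 0)) := by
    by_cases h : G.Adj x (C 0)
    · exact ⟨h.toWalk⟩
    · obtain ⟨p, -⟩ := hG.reach _ _ h
      exact ⟨p⟩
  have base : ∃ j, G.Adj (C 0) (C (j - 1)) ∧ G.Adj (C 0) (C (j + 1)) :=
    ⟨0, by simpa using (hC (0 - 1)).symm, hC 0⟩
  generalize C 0 = z at p base
  induction p with
  | nil => exact base
  | cons h p ih =>
    obtain ⟨i, h1, h2⟩ := ih base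
    exact hG.exists_attached_of_adj hk hdeg hC h h1 h2

/-- Once `x` replaces `C i`, the vertex `y` sees `x`, `C (j-1)` and `C (j+1)`, which is one too many
unless `i` is `j - 1` or `j + 1`. -/
theorem CyclicWalk.eq_add_one_or_eq_sub_one {C : ZMod (2 * k + 1) → V} (hk : 2 ≤ k)
    (hG : G.OddClosedWalksAtLeast (2 * k + 1)) (hC : G.CyclicWalk k C) {x y : V}
    (hxy : G.Adj x y) {i j : ZMod (2 * k + 1)} (hx : G.Adj x (C (i - 1)) ∧ G.Adj x (C (i + 1)))
    (hy : G.Adj y (C (j - 1)) ∧ G.Adj y (C (j + 1))) : j - i = 1 ∨ i - j = 1 := by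
  classical
  have n2 : (2 : ZMod (2 * k + 1)) ≠ 0 := by
    exact_mod_cast natCast_zmod_ne_zero (k := k) two_ne_zero (by omega)
  by_contra! hcon
  have e1 : j - 1 ≠ i := fun e ↦ hcon.1 (by linear_combination e)
  have e2 : j + 1 ≠ i := fun e ↦ hcon.2 (by linear_combination -e)
  refine (hC.update hk hx.1 hx.2).not_adj_three hk hG (v := y) (i := i) (j := j - 1) (l := j + 1)
    e1.symm e2.symm (fun e ↦ n2 (by linear_combination -e)) ?_ ?_ ?_
  · rw [Function.update_self]
    exact hxy.symm
  · rw [Function.update_of_ne e1]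
    exact hy.1
  · rw [Function.update_of_ne e2]
    exact hy.2

/-- Let `n > 2k+1` be the least odd length. If `f 0` and `f 3` are adjacent, the shortcut has length
`n-2`; otherwise the first three steps and a walk of length `2k-2` close up to length `2k+1`. -/
theorem OddSaturated.exists_closedSeq (hk : 2 ≤ k) (hG : G.OddSaturated k)
    (h : ∃ n u, G.ReachIn n u u ∧ n % 2 = 1) : ∃ f, G.ClosedSeq (2 * k + 1) f := by
  classical
  obtain ⟨u, hu, hodd⟩ := Nat.find_spec h
  have hmin := fun m (hm : m < Nat.find h) ↦ Nat.find_min h hm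
  generalize Nat.find h = n at hu hodd hmin
  obtain ⟨f, f0, fn, hf⟩ := hu.exists_seq
  have hle := hG.odd _ _ hu hodd
  suffices n ≤ 2 * k + 1 by
    obtain rfl : n = 2 * k + 1 := by omega
    exact ⟨f, by rw [f0, fn], hf⟩
  have r1 := ReachIn.of_seq (G := G) (f := f) (i := 0) (j := 3) (by omega)
    fun l _ hl ↦ hf l (by omega)
  have r2 := ReachIn.of_seq (G := G) (f := f) (i := 3) (j := n) (by omega)
    fun l _ hl ↦ hf l (by omega)
  rw [fn, ← f0] at r2
  by_cases h3 : G.Adj (f 0) (f 3)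
  · exact (hmin _ (by omega) ⟨f 0, h3.reachIn.trans r2, by omega⟩).elim
  · by_contra! hlt
    exact hmin _ (by omega) ⟨f 0, r1.trans (hG.reach _ _ h3).symm, by omega⟩

theorem OddSaturated.isHomomorphicTo_cycleGraph [Fintype V] (hk : 2 ≤ k) (hG : G.OddSaturated k)
    (hdeg : G.DegreesLarge k) : G.IsHomomorphicTo (cycleGraph (2 * k + 1)) := by
  by_cases h : ∃ n u, G.ReachIn n u u ∧ n % 2 = 1
  · obtain ⟨f, hf⟩ := hG.exists_closedSeq hk h
    obtain ⟨C, hC⟩ := hf.exists_cyclicWalk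
    choose φ hφ using hG.exists_attached hk hdeg hC
    have h1 : (1 : ZMod (2 * k + 1)).val = 1 := ZMod.val_one'' (by omega)
    -- `ZMod (2 * k + 1)` unfolds to `Fin (2 * k + 1)`, the vertex type of the cycle.
    refine ⟨⟨fun x ↦ (φ x : ZMod (2 * k + 1)), fun {x y} hxy ↦ ?_⟩⟩
    refine cycleGraph_adj'.2 ?_
    rcases hC.eq_add_one_or_eq_sub_one hk hG.odd hxy (hφ x) (hφ y) with e | e
    · exact Or.inr ((congrArg ZMod.val e).trans h1)
    · exact Or.inl ((congrArg ZMod.val e).trans h1)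
  · have hcol : G.Colorable 2 := by
      rw [two_colorable_iff_forall_loop_even]
      intro u w
      by_contra hw
      exact h ⟨w.length, u, ⟨w, rfl⟩, Nat.odd_iff.1 (Nat.not_even_iff_odd.1 hw)⟩
    obtain ⟨c⟩ := hcol
    have h01 : (cycleGraph (2 * k + 1)).Adj ⟨0, by omega⟩ ⟨1, by omega⟩ := by
      rw [cycleGraph_adj']
      right
      rw [Fin.sub_def]
      simp
      omega
    refine ⟨⟨fun x ↦ if c x = 0 then ⟨0, by omega⟩ else ⟨1, by omega⟩, fun {x y} hxy ↦ ?_⟩⟩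
    have hne := c.valid hxy
    by_cases hx : c x = 0
    · have hy : c y ≠ 0 := fun hy ↦ hne (hx.trans hy.symm)
      simpa [hx, hy] using h01
    · have hy : c y = 0 := by omega
      simpa [hx, hy] using h01.symm

end CycleColouring

end SimpleGraph

theorem theorem2 (k : ℕ) (hk : 2 ≤ k) (n : ℕ) {V : Type*} [Fintype V]
    (hn : Fintype.card V = n) (G : SimpleGraph V) [DecidableRel G.Adj]
    (hdeg : (3 * (n : ℝ)) / (4 * (k : ℝ)) < (G.minDegree : ℝ))
    (hodd : G.OddGirthAtLeast (2 * k + 1)) :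
    G.IsHomomorphicTo (SimpleGraph.cycleGraph (2 * k + 1)) := by
  have hlarge : G.DegreesLarge k := by
    intro v
    have h1 : G.minDegree ≤ (G.neighborSet v).ncard := by
      rw [Set.ncard_eq_toFinset_card']
      exact G.minDegree_le_degree v
    have hk0 : (0 : ℝ) < 4 * k := by
      have : (2 : ℝ) ≤ k := by exact_mod_cast hk
      linarith
    rw [div_lt_iff₀ hk0] at hdeg
    have h2 : 3 * n < G.minDegree * (4 * k) := by exact_mod_cast hdeg
    rw [hn]
    nlinarith
  have hne : ∀ v, ∃ w, G.Adj v w := by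
    intro v
    have h1 : 0 < (G.neighborSet v).ncard := by
      by_contra! h0
      have := hlarge v
      rw [Nat.le_zero.1 h0] at this
      omega
    exact (Set.ncard_pos (Set.toFinite _)).1 h1
  obtain ⟨H, hGH, hH⟩ := hodd.oddClosedWalksAtLeast.exists_oddSaturated hk hne
  obtain ⟨φ⟩ := hH.isHomomorphicTo_cycleGraph hk (hlarge.mono hGH)
  exact ⟨φ.comp (SimpleGraph.Hom.ofLE hGH)⟩
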